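/- \textbf{Scenario.} Fix $N$ parties, each with $M$ settings and $D$ outcomes. A correlation is a family $p(\vec x|\vec a)\ge 0$, $\vec x\in\{0,\dots,D-1\}^N$, $\vec a\in\{0,\dots,M-1\}^N$, with $\sum_{\vec x}p(\vec x|\vec a)=1$ for every $\vec a$. It is \emph{causal} if $N\le 1$, or if $p(\vec x|\vec a)=\sum_{k}q_k\,p_k(x_k|a_k)\,p_{k,x_k}^{a_k}(\vec x_{\backslash k}|\vec a_{\backslash k})$ with $q_k\ge 0$, $\sum_k q_k=1$, one-party correlations $p_k$, and causal $(N-1)$-party correlations $p_{k,x_k}^{a_k}$. \textbf{Classical processes.} Party $k$ has a finite non-empty input set $I_k$ and a finite non-empty output set $O_k$; $\vec I=\prod_k I_k$, $\vec O=\prod_k O_k$. Its local intervention is a conditional distribution $p(x_k,o_k|a_k,i_k)$. A \emph{quasi-process} is any conditional distribution $p(\vec i|\vec o)$. It is a \emph{classical process} if for all local interventions (with any finite numbers of settings and outcomes) $\big(\prod_k p(x_k,o_k|a_k,i_k)\big)p(\vec i|\vec o)$ is, for every $\vec a$, a probability distribution in $(\vec x,\vec i,\vec o)$. A \emph{process function}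 is a map $\omega:\vec O\to\vec I$ such that $\delta_{\vec i,\omega(\vec o)}$ is a classical process. A quasi-process together with local interventions realizes $p(\vec x|\vec a)=\sum_{\vec i,\vec o}\big(\prod_k p(x_k,o_k|a_k,i_k)\big)p(\vec i|\vec o)$. \textbf{Process matrices.} Let $\mathcal H^{I_k},\mathcal H^{O_k}$ be non-zero finite-dimensional Hilbert spaces with fixed bases. A process matrix is an operator $W\ge 0$ on $\bigotimes_k(\mathcal H^{I_k}\otimes\mathcal H^{O_k})$ with $\mathrm{Tr}(W\bigotimes_k M_k)=1$ for all $M_k\ge 0$ on $\mathcal H^{I_k}\otimes\mathcal H^{O_k}$ with $\mathrm{Tr}_{O_k}M_k=\mathbb 1$. With quantum instruments (completely positive maps $\mathcal M^{k}_{x|a}:\mathcal L(\mathcal H^{I_k})\to\mathcal L(\mathcal H^{O_k})$ whose sum over $x$ is trace preserving) it realizes $p(\vec x|\vec a)=\mathrm{Tr}(W\bigotimes_k M^{k}_{x_k|a_k})$, where $M^{k}_{x|a}=[(\mathrm{id}\otimes\mathcal M^{k}_{x|a})(\sum_{j,l}|jj\rangle\langle ll|)]^{T}$. \textbf{Sets.}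 In each scenario $(N,M,D)$ let $\mathcal{DC}$, $\mathcal{PC}$, $\mathcal{qC}$ be the sets of correlations realized, for some choice of the sets $I_k,O_k$ and of local interventions, respectively by a convex combination of the deterministic processes $\delta_{\vec i,\omega(\vec o)}$ of process functions $\omega$, by a classical process, and by a quasi-process. Let $\mathcal{QP}$ be the set of correlations realized by some process matrix with some instruments. \textbf{Theorem.} \begin{enumerate} \item In every scenario $(N,M,D)$: $\mathcal{DC}\subseteq\mathcal{PC}\subseteq\mathcal{QP}\subseteq\mathcal{qC}$. \item In every scenario with $N\ge 3$ and $M,D\ge 2$ all inclusions are strict: $\mathcal{DC}\subsetneq\mathcal{PC}\subsetneq\mathcal{QP}\subsetneq\mathcal{qC}$. \item For $N=2$ and all $M,D$: $\mathcal{DC}=\mathcal{PC}$, and every correlation in $\mathcal{PC}$ is causal. If moreover $M,D\ge 2$, then $\mathcal{PC}\subsetneq\mathcal{QP}\subsetneq\mathcal{qC}$. \item For $(N,M,D)=(2,2,2)$, every causal correlation satisfies $$p_{\rm gyni}:=\tfrac14\sum_{\vec a}\sum_{\vec x:\,x_1=a_2,\,x_2=a_1}p(\vec x|\vec a)\le\tfrac12,\qquad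 p_{\rm lgyni}:=\tfrac14\sum_{\vec a}\sum_{\vec x:\,a_1(x_1\oplus a_2)=0,\,a_2(x_2\oplus a_1)=0}p(\vec x|\vec a)\le\tfrac34 .$$ \item For two parties with qubit inputs and outputs, in the order $I_1,O_1,I_2,O_2$, $$W=\tfrac14\Big[\mathbb 1+\tfrac1{\sqrt2}\big(Z\otimes Z\otimes Z\otimes\mathbb 1+Z\otimes\mathbb 1\otimes X\otimes X\big)\Big]$$ is a process matrix. Let each party, for setting $0$, apply the identity channel and return outcome $1$, and, for setting $1$, measure in the $Z$ basis, return the result, and prepare $|0\rangle\langle 0|$. These are quantum instruments, and the resulting correlation lies in $\mathcal{QP}$ and has $p_{\rm gyni}=\tfrac5{16}\big(1+\tfrac1{\sqrt2}\big)\approx 0.533>\tfrac12$ and $p_{\rm lgyni}=\tfrac14+\tfrac5{16}\big(1+\tfrac1{\sqrt2}\big)\approx 0.783>\tfrac34$. \end{enumerate} -/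

import Mathlib

open scoped BigOperators ComplexOrder

noncomputable section

/-! ### Correlations -/

/-- A correlation in the scenario with `N` parties, `M` settings per party and `D` outcomes per
setting; `prob x a` is `p(x | a)`. -/
structure Correlation (N M D : ℕ) where
  prob : (Fin N → Fin D) → (Fin N → Fin M) → ℝ
  nonneg : ∀ x a, 0 ≤ prob x a
  sum_one : ∀ a, ∑ x, prob x a = 1

/-- Causal correlations, by recursion on the number of parties: a one-party correlation is causal,
and a correlation of at least two parties is causal if it is a mixture, with weights `q k` not
depending on any setting, of correlations in which party `k` acts first (with outcome distribution
`r k` depending on its own setting only) and the remaining parties share a causal correlation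
`s k (x k) (a k)` that may depend on the setting and the outcome of party `k`.
(The unique correlation of zero parties is counted as causal.) -/
def IsCausal {M D : ℕ} : {N : ℕ} → Correlation N M D → Prop
  | 0, _ => True
  | 1, _ => True
  | n + 2, P =>
    ∃ (q : Fin (n + 2) → ℝ) (r : Fin (n + 2) → Correlation 1 M D)
      (s : Fin (n + 2) → Fin D → Fin M → Correlation (n + 1) M D),
      (∀ k, 0 ≤ q k) ∧ ∑ k, q k = 1 ∧ (∀ k x a, IsCausal (s k x a)) ∧
      ∀ x a, P.prob x a =
        ∑ k, q k * (r k).prob (fun _ => x k) (fun _ => a k) *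
          (s k (x k) (a k)).prob (k.removeNth x) (k.removeNth a)

/-! ### Classical processes -/

/-- A local classical intervention `p(x, o | a, i)` of one party with `M` settings, `D` outcomes,
an input system of cardinality `dI` and an output system of cardinality `dO`;
`prob x o a i` is `p(x, o | a, i)`. -/
structure LocalIntervention (M D dI dO : ℕ) where
  prob : Fin D → Fin dO → Fin M → Fin dI → ℝ
  nonneg : ∀ x o a i, 0 ≤ prob x o a i
  sum_one : ∀ a i, ∑ x, ∑ o, prob x o a i = 1

/-- Real arrays `P i o`, to be read as `p(i | o)`, from the output variables to the input variables
of `N` parties. -/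
abbrev Environment {N : ℕ} (dI dO : Fin N → ℕ) : Type :=
  ((k : Fin N) → Fin (dI k)) → ((k : Fin N) → Fin (dO k)) → ℝ

/-- A classical quasi-process: an arbitrary conditional probability distribution `p(i | o)`. -/
def IsQuasiProcess {N : ℕ} {dI dO : Fin N → ℕ} (P : Environment dI dO) : Prop :=
  (∀ i o, 0 ≤ P i o) ∧ ∀ o, ∑ i, P i o = 1

/-- `p(x, i, o | a) = (∏ k, p(x_k, o_k | a_k, i_k)) p(i | o)`. -/
def jointProb {N M D : ℕ} {dI dO : Fin N → ℕ} (P : Environment dI dO)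
    (L : (k : Fin N) → LocalIntervention M D (dI k) (dO k))
    (x : Fin N → Fin D) (i : (k : Fin N) → Fin (dI k)) (o : (k : Fin N) → Fin (dO k))
    (a : Fin N → Fin M) : ℝ :=
  (∏ k, (L k).prob (x k) (o k) (a k) (i k)) * P i o

/-- Logical consistency: for all local interventions, with any numbers of settings and outcomes,
`p(x, i, o | a)` is a conditional probability distribution. -/
def IsLogicallyConsistent {N : ℕ} {dI dO : Fin N → ℕ} (P : Environment dI dO) : Prop :=
  ∀ (M D : ℕ) (L : (k : Fin N) → LocalIntervention M D (dI k) (dO k)) (a : Fin N → Fin M),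
    (∀ x i o, 0 ≤ jointProb P L x i o a) ∧ ∑ x, ∑ i, ∑ o, jointProb P L x i o a = 1

/-- A classical process: a logically consistent classical quasi-process. -/
def IsClassicalProcess {N : ℕ} {dI dO : Fin N → ℕ} (P : Environment dI dO) : Prop :=
  IsQuasiProcess P ∧ IsLogicallyConsistent P

/-- The deterministic quasi-process `p(i | o) = δ_{i, ω(o)}` of a quasi-process function `ω`. -/
def deltaProcess {N : ℕ} {dI dO : Fin N → ℕ}
    (ω : ((k : Fin N) → Fin (dO k)) → ((k : Fin N) → Fin (dI k))) : Environment dI dO :=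
  fun i o => if i = ω o then 1 else 0

/-- A process function: a quasi-process function whose deterministic quasi-process is a classical
process. -/
def IsProcessFunction {N : ℕ} {dI dO : Fin N → ℕ}
    (ω : ((k : Fin N) → Fin (dO k)) → ((k : Fin N) → Fin (dI k))) : Prop :=
  IsClassicalProcess (deltaProcess ω)

/-- The deterministic-extrema polytope: the convex hull of all deterministic classical processes. -/
def detExtremaPolytope {N : ℕ} (dI dO : Fin N → ℕ) : Set (Environment dI dO) :=
  convexHull ℝ {P | ∃ ω : ((k : Fin N) → Fin (dO k)) → ((k : Fin N) → Fin (dI k)),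
    IsProcessFunction ω ∧ P = deltaProcess ω}

/-- The array `∑_{i, o} (∏ k, p(x_k, o_k | a_k, i_k)) p(i | o)` that an environment and local
interventions give rise to. -/
def classicalProb {N M D : ℕ} {dI dO : Fin N → ℕ} (P : Environment dI dO)
    (L : (k : Fin N) → LocalIntervention M D (dI k) (dO k))
    (x : Fin N → Fin D) (a : Fin N → Fin M) : ℝ :=
  ∑ i, ∑ o, jointProb P L x i o a

/-! ### Process matrices -/

/-- `(id_n ⊗ Φ)(X)` for a linear map `Φ` from `dI × dI` to `dO × dO` matrices. -/
def ampliation {n dI dO : ℕ}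
    (Φ : Matrix (Fin dI) (Fin dI) ℂ →ₗ[ℂ] Matrix (Fin dO) (Fin dO) ℂ)
    (X : Matrix (Fin n × Fin dI) (Fin n × Fin dI) ℂ) :
    Matrix (Fin n × Fin dO) (Fin n × Fin dO) ℂ :=
  Matrix.of fun s t => Φ (Matrix.of fun i j => X (s.1, i) (t.1, j)) s.2 t.2

/-- Complete positivity. -/
def IsCompletelyPositive {dI dO : ℕ}
    (Φ : Matrix (Fin dI) (Fin dI) ℂ →ₗ[ℂ] Matrix (Fin dO) (Fin dO) ℂ) : Prop :=
  ∀ (n : ℕ) (X : Matrix (Fin n × Fin dI) (Fin n × Fin dI) ℂ),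
    X.PosSemidef → (ampliation Φ X).PosSemidef

/-- A quantum instrument with outcomes in `Fin D`: completely positive maps whose sum is trace
preserving. -/
def IsInstrument {D dI dO : ℕ}
    (Φ : Fin D → (Matrix (Fin dI) (Fin dI) ℂ →ₗ[ℂ] Matrix (Fin dO) (Fin dO) ℂ)) : Prop :=
  (∀ x, IsCompletelyPositive (Φ x)) ∧ ∀ ρ, (∑ x, Φ x ρ).trace = ρ.trace

/-- `d |Φ⁺⟩⟨Φ⁺|` for the maximally entangled state `|Φ⁺⟩ = d^(-1/2) ∑ j, |j⟩|j⟩`. -/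
def unnormalizedMaxEntangled (d : ℕ) : Matrix (Fin d × Fin d) (Fin d × Fin d) ℂ :=
  Matrix.of fun s t => if s.1 = s.2 ∧ t.1 = t.2 then 1 else 0

/-- The Choi-Jamiołkowski matrix `[(id ⊗ Φ)(d |Φ⁺⟩⟨Φ⁺|)]ᵀ` of a linear map `Φ`. -/
def choiMatrix {dI dO : ℕ}
    (Φ : Matrix (Fin dI) (Fin dI) ℂ →ₗ[ℂ] Matrix (Fin dO) (Fin dO) ℂ) :
    Matrix (Fin dI × Fin dO) (Fin dI × Fin dO) ℂ :=
  (ampliation Φ (unnormalizedMaxEntangled dI)).transpose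

/-- Partial trace over the output system. -/
def traceOut {dI dO : ℕ} (A : Matrix (Fin dI × Fin dO) (Fin dI × Fin dO) ℂ) :
    Matrix (Fin dI) (Fin dI) ℂ :=
  Matrix.of fun i j => ∑ o, A (i, o) (j, o)

/-- Operators on the tensor product over all parties `k` of `ℋ^{I_k} ⊗ ℋ^{O_k}`. -/
abbrev GlobalOperator {N : ℕ} (dI dO : Fin N → ℕ) : Type :=
  Matrix ((k : Fin N) → Fin (dI k) × Fin (dO k)) ((k : Fin N) → Fin (dI k) × Fin (dO k)) ℂ

/-- The tensor product over all parties of local operators. -/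
def tensorOperator {N : ℕ} {dI dO : Fin N → ℕ}
    (A : (k : Fin N) → Matrix (Fin (dI k) × Fin (dO k)) (Fin (dI k) × Fin (dO k)) ℂ) :
    GlobalOperator dI dO :=
  Matrix.of fun s t => ∏ k, A k (s k) (t k)

/-- A process matrix: `W ≥ 0`, and `Tr (W ⨂_k A_k) = 1` whenever all `A_k ≥ 0` satisfy
`Tr_{O_k} A_k = 1`. -/
def IsProcessMatrix {N : ℕ} {dI dO : Fin N → ℕ} (W : GlobalOperator dI dO) : Prop :=
  W.PosSemidef ∧
  ∀ A : (k : Fin N) → Matrix (Fin (dI k) × Fin (dO k)) (Fin (dI k) × Fin (dO k)) ℂ,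
    (∀ k, (A k).PosSemidef ∧ traceOut (A k) = 1) → (W * tensorOperator A).trace = 1

/-- `Tr (W ⨂_k M_{x_k | a_k})`, where `M_{x_k | a_k}` is the Choi-Jamiołkowski matrix of the map
`Φ k (a k) (x k)`. -/
def quantumProb {N M D : ℕ} {dI dO : Fin N → ℕ} (W : GlobalOperator dI dO)
    (Φ : (k : Fin N) → Fin M → Fin D →
      (Matrix (Fin (dI k)) (Fin (dI k)) ℂ →ₗ[ℂ] Matrix (Fin (dO k)) (Fin (dO k)) ℂ))
    (x : Fin N → Fin D) (a : Fin N → Fin M) : ℂ :=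
  (W * tensorOperator fun k => choiMatrix (Φ k (a k) (x k))).trace

/-! ### The four sets of correlations -/

/-- Deterministically consistent correlations. -/
def DC (N M D : ℕ) : Set (Correlation N M D) :=
  {p | ∃ dI dO : Fin N → ℕ, (∀ k, 0 < dI k) ∧ (∀ k, 0 < dO k) ∧
    ∃ P ∈ detExtremaPolytope dI dO,
    ∃ L : (k : Fin N) → LocalIntervention M D (dI k) (dO k),
      ∀ x a, p.prob x a = classicalProb P L x a}

/-- Probabilistically consistent correlations. -/
def PC (N M D : ℕ) : Set (Correlation N M D) :=
  {p | ∃ dI dO : Fin N → ℕ, (∀ k, 0 < dI k) ∧ (∀ k, 0 < dO k) ∧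
    ∃ P : Environment dI dO, IsClassicalProcess P ∧
    ∃ L : (k : Fin N) → LocalIntervention M D (dI k) (dO k),
      ∀ x a, p.prob x a = classicalProb P L x a}

/-- Quantum process correlations. -/
def QP (N M D : ℕ) : Set (Correlation N M D) :=
  {p | ∃ dI dO : Fin N → ℕ, (∀ k, 0 < dI k) ∧ (∀ k, 0 < dO k) ∧
    ∃ W : GlobalOperator dI dO, IsProcessMatrix W ∧
    ∃ Φ : (k : Fin N) → Fin M → Fin D →
        (Matrix (Fin (dI k)) (Fin (dI k)) ℂ →ₗ[ℂ] Matrix (Fin (dO k)) (Fin (dO k)) ℂ),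
      (∀ k a, IsInstrument (Φ k a)) ∧ ∀ x a, (p.prob x a : ℂ) = quantumProb W Φ x a}

/-- Quasi-consistent correlations. -/
def qC (N M D : ℕ) : Set (Correlation N M D) :=
  {p | ∃ dI dO : Fin N → ℕ, (∀ k, 0 < dI k) ∧ (∀ k, 0 < dO k) ∧
    ∃ P : Environment dI dO, IsQuasiProcess P ∧
    ∃ L : (k : Fin N) → LocalIntervention M D (dI k) (dO k),
      ∀ x a, p.prob x a = classicalProb P L x a}

/-! ### The bipartite games and the qubit process matrix -/

/-- Success probability in the game "guess your neighbour's input" with uniform inputs. -/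
def gyni (p : Correlation 2 2 2) : ℝ :=
  1 / 4 * ∑ a, ∑ x, if x 0 = a 1 ∧ x 1 = a 0 then p.prob x a else 0

/-- Success probability in the lazy game with uniform inputs; addition in `Fin 2` is addition
modulo two. -/
def lgyni (p : Correlation 2 2 2) : ℝ :=
  1 / 4 * ∑ a, ∑ x,
    if a 0 * (x 0 + a 1) = 0 ∧ a 1 * (x 1 + a 0) = 0 then p.prob x a else 0

def pauliX : Matrix (Fin 2) (Fin 2) ℂ := !![0, 1; 1, 0]

def pauliZ : Matrix (Fin 2) (Fin 2) ℂ := !![1, 0; 0, -1]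

/-- `W = 1/4 [1 + (Z^{I₁} Z^{O₁} Z^{I₂} 1^{O₂} + Z^{I₁} 1^{O₁} X^{I₂} X^{O₂}) / √2]`, two parties with
a qubit input and a qubit output each. -/
def qubitW : GlobalOperator (N := 2) (fun _ => 2) (fun _ => 2) :=
  (1 / 4 : ℂ) • (1 + (1 / (Real.sqrt 2 : ℂ)) •
    (tensorOperator (N := 2) (dI := fun _ => 2) (dO := fun _ => 2)
        ![Matrix.kronecker pauliZ pauliZ, Matrix.kronecker pauliZ 1] +
      tensorOperator (N := 2) (dI := fun _ => 2) (dO := fun _ => 2)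
        ![Matrix.kronecker pauliZ 1, Matrix.kronecker pauliX pauliX]))

/-- The maps `qubitMap a x` that either party uses. Setting `0`: apply the identity channel and
return outcome `1`. Setting `1`: measure in the `Z` basis, return the result `x`, and prepare
`|0⟩⟨0|`. -/
def qubitMap (a x : Fin 2) : Matrix (Fin 2) (Fin 2) ℂ →ₗ[ℂ] Matrix (Fin 2) (Fin 2) ℂ :=
  if a = 0 then (if x = 0 then 0 else LinearMap.id)
  else (Matrix.entryLinearMap ℂ ℂ x x).smulRight (Matrix.single 0 0 1)

end

noncomputable section

/-! ### Classical processes as multilinear forms -/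

/-! Environments and process matrices are treated as multilinear forms in the local operations. A
form is positive on positive arguments and, for a process, equals one on all tuples of channels.
Fixing channels for all but two parties leaves a bipartite process, so two-party arguments apply to
any number of parties.

Inclusions. Stochastic arrays are mixtures of deterministic ones, so an environment is a classical
process exactly when `∑ i, P i (f i) = 1` for all local maps `f` (`isClassicalProcess_iff`). For a
function `ω` this says that each `ω ∘ f` has a unique fixed point (`isProcessFunction_iff`). The
criterion is convex, whence DC ⊆ PC. A classical process is a diagonal process matrix probed by
measure-and-prepare instruments, whence PC ⊆ QP. Finally qC contains every correlation, because an
arbitrary `p(i | o)` may read the settings and return the outcomes (`mem_qC`).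

Two classical parties. Consistency forces the dependence of `P` on the two outputs to be additive,
and subtracting a minimum splits `P` into two nonnegative one-way signalling parts
(`exists_ordered_decomposition`). Splitting these further into deterministic parts gives DC = PC;
reading them as causal orders gives causality. The same decomposition bounds mutual guessing in
every reduced bipartite process (`two_way_bound`).

PC ≠ QP. The process `qubitW`, extended by idle bystanders, exceeds this bound. It is positive
because its two Pauli strings are anticommuting involutions, and normalized because each string has
a traceless factor with trivial action on an output.

QP ≠ qC. Two parties cannot learn each other's settings with certainty
(`not_perfect_two_way_signalling`). Perfect success determines the form on operators reduced to the
inputs. A test channel built only from losing events and reduced effects must still have total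
weight one, which forces some reduced joint weight to vanish. Since an operator is dominated by a
multiple of its reduction, a winning event of probability one would then have probability zero.

DC ≠ PC for three or more parties. The even mixture of the identity loop and the flipping loop on
three bits is a classical process, and it makes the outcomes equal to the cyclically shifted
settings up to a common flip. No process function achieves this: a party could compute from its
input the outcomes for both of its settings, and a suitable choice of settings from these outcomes
would create two fixed points (`IsProcessFunction.exists_not_isShiftOrNot`). A linear functional,
the failure probability, extends the exclusion from process functions to their convex hull. -/

/-- The form `h ↦ ∑_{i, o} (∏ k, h_k(i_k, o_k)) P(i, o)` of an environment. -/
def processForm {N : ℕ} {dI dO : Fin N → ℕ} (P : Environment dI dO) :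
    MultilinearMap ℝ (fun k => Fin (dI k) → Fin (dO k) → ℝ) ℝ :=
  ∑ i, ∑ o, P i o • (MultilinearMap.mkPiAlgebra ℝ (Fin N) ℝ).compLinearMap
    fun k => LinearMap.proj (o k) ∘ₗ LinearMap.proj (i k)

theorem processForm_apply {N : ℕ} {dI dO : Fin N → ℕ} (P : Environment dI dO)
    (h : (k : Fin N) → Fin (dI k) → Fin (dO k) → ℝ) :
    processForm P h = ∑ i, ∑ o, (∏ k, h k (i k) (o k)) * P i o := by
  simp [processForm, mul_comm]

theorem processForm_nonneg {N : ℕ} {dI dO : Fin N → ℕ} {P : Environment dI dO}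
    (hP : ∀ i o, 0 ≤ P i o) {h : (k : Fin N) → Fin (dI k) → Fin (dO k) → ℝ}
    (hh : ∀ k i o, 0 ≤ h k i o) : 0 ≤ processForm P h := by
  rw [processForm_apply]
  exact Finset.sum_nonneg fun i _ => Finset.sum_nonneg fun o _ =>
    mul_nonneg (Finset.prod_nonneg fun k _ => hh _ _ _) (hP _ _)

theorem processForm_mono {N : ℕ} {dI dO : Fin N → ℕ} {P : Environment dI dO}
    (hP : ∀ i o, 0 ≤ P i o) {h h' : (k : Fin N) → Fin (dI k) → Fin (dO k) → ℝ}
    (hh : ∀ k i o, 0 ≤ h k i o) (hle : ∀ k i o, h k i o ≤ h' k i o) :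
    processForm P h ≤ processForm P h' := by
  rw [processForm_apply, processForm_apply]
  exact Finset.sum_le_sum fun i _ => Finset.sum_le_sum fun o _ =>
    mul_le_mul_of_nonneg_right (Finset.prod_le_prod (fun k _ => hh _ _ _) fun k _ => hle _ _ _)
      (hP _ _)

/-- Each party sums over its own index type, and the product distributes over the sums. This serves
both for outcomes and for mixtures of deterministic maps. -/
theorem processForm_sum {N : ℕ} {dI dO : Fin N → ℕ} (P : Environment dI dO) {δ : Fin N → Type*}
    [∀ k, Fintype (δ k)] (h : (k : Fin N) → δ k → Fin (dI k) → Fin (dO k) → ℝ) :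
    processForm P (fun k i o => ∑ x, h k x i o) =
      ∑ x : (k : Fin N) → δ k, processForm P fun k => h k (x k) := by
  simp_rw [processForm_apply]
  conv_rhs => rw [Finset.sum_comm]
  refine Finset.sum_congr rfl fun i _ => ?_
  conv_rhs => rw [Finset.sum_comm]
  refine Finset.sum_congr rfl fun o _ => ?_
  rw [Finset.prod_univ_sum, Finset.sum_mul, Fintype.piFinset_univ]

theorem processForm_deterministic {N : ℕ} {dI dO : Fin N → ℕ} (P : Environment dI dO)
    (f : (k : Fin N) → Fin (dI k) → Fin (dO k)) :
    processForm P (fun k i o => if f k i = o then 1 else 0) =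
      ∑ i, P i fun k => f k (i k) := by
  rw [processForm_apply]
  refine Finset.sum_congr rfl fun i _ => ?_
  rw [Finset.sum_eq_single fun k => f k (i k)]
  · simp
  · intro o _ ho
    obtain ⟨k, hk⟩ := Function.ne_iff.1 ho
    rw [Finset.prod_eq_zero (Finset.mem_univ k), zero_mul]
    simp [hk.symm]
  · simp

/-- A stochastic matrix is a mixture of deterministic ones. -/
theorem sum_prod_mul_indicator {ι κ : Type*} [Fintype ι] [DecidableEq ι] [Fintype κ]
    [DecidableEq κ] (C : ι → κ → ℝ) (hC : ∀ i, ∑ o, C i o = 1) (i : ι) (o : κ) :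
    ∑ f : ι → κ, (∏ j, C j (f j)) * (if f i = o then 1 else 0) = C i o := by
  -- With the indicator absorbed into the factor at `i`, the sum over `f` factorizes; every row
  -- other than `i` contributes its sum, which is one.
  have key : ∀ f : ι → κ, (∏ j, C j (f j)) * (if f i = o then 1 else 0) =
      ∏ j, C j (f j) * (if j = i then if f j = o then 1 else 0 else 1) := by
    intro f
    rw [Finset.prod_mul_distrib, Finset.prod_ite_eq' Finset.univ i]
    simp
  simp_rw [key]
  rw [← Fintype.piFinset_univ, ← Finset.prod_univ_sum (fun _ => Finset.univ)
    (fun j o' => C j o' * (if j = i then if o' = o then 1 else 0 else 1)),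
    Finset.prod_eq_single i]
  · simp
  · intro j _ hj
    simp [hj, hC]
  · simp

theorem sum_prod_eq_one {ι κ : Type*} [Fintype ι] [DecidableEq ι] [Fintype κ]
    (C : ι → κ → ℝ) (hC : ∀ i, ∑ o, C i o = 1) : ∑ f : ι → κ, ∏ j, C j (f j) = 1 := by
  rw [← Fintype.piFinset_univ, ← Finset.prod_univ_sum (fun _ => Finset.univ) C]
  simp [hC]

/-- Each stochastic array is a combination of deterministic maps with product weights, so
multilinearity reduces to the deterministic case and the weights sum to one. The identity is
algebraic: only the row sums of `C` matter, not its signs. -/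
theorem processForm_eq_one {N : ℕ} {dI dO : Fin N → ℕ} {P : Environment dI dO}
    (hP : ∀ f : (k : Fin N) → Fin (dI k) → Fin (dO k), ∑ i, P i (fun k => f k (i k)) = 1)
    {C : (k : Fin N) → Fin (dI k) → Fin (dO k) → ℝ} (hC : ∀ k i, ∑ o, C k i o = 1) :
    processForm P C = 1 := by
  have h1 : C = fun k i o => ∑ f : Fin (dI k) → Fin (dO k),
      (∏ j, C k j (f j)) * (if f i = o then 1 else 0) := by
    funext k i o
    rw [sum_prod_mul_indicator _ (hC k)]
  have h2 : ∀ f : (k : Fin N) → Fin (dI k) → Fin (dO k),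
      processForm P (fun k i o => (∏ j, C k j (f k j)) * (if f k i = o then 1 else 0)) =
        ∏ k, ∏ j, C k j (f k j) := by
    intro f
    have := (processForm P).map_smul_univ (fun k => ∏ j, C k j (f k j))
      (fun k i o => if f k i = o then 1 else 0)
    rw [processForm_deterministic, hP] at this
    rw [smul_eq_mul, mul_one] at this
    exact this
  rw [h1, processForm_sum P fun k (f : Fin (dI k) → Fin (dO k)) i o =>
    (∏ j, C k j (f j)) * (if f i = o then 1 else 0)]
  simp_rw [h2]
  rw [← Fintype.piFinset_univ, ← Finset.prod_univ_sum (fun _ => Finset.univ)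
    (fun k (f : Fin (dI k) → Fin (dO k)) => ∏ j, C k j (f j))]
  simp [sum_prod_eq_one _ (hC _)]

theorem classicalProb_eq_processForm {N M D : ℕ} {dI dO : Fin N → ℕ} (P : Environment dI dO)
    (L : (k : Fin N) → LocalIntervention M D (dI k) (dO k))
    (x : Fin N → Fin D) (a : Fin N → Fin M) :
    classicalProb P L x a = processForm P fun k i o => (L k).prob (x k) o (a k) i := by
  rw [processForm_apply]
  rfl

theorem sum_classicalProb {N M D : ℕ} {dI dO : Fin N → ℕ} (P : Environment dI dO)
    (L : (k : Fin N) → LocalIntervention M D (dI k) (dO k)) (a : Fin N → Fin M) :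
    ∑ x, classicalProb P L x a =
      processForm P fun k i o => ∑ x, (L k).prob x o (a k) i := by
  rw [processForm_sum P fun k x i o => (L k).prob x o (a k) i]
  simp_rw [classicalProb_eq_processForm]

/-- Classical processes are characterized by deterministic interventions. -/
theorem isClassicalProcess_iff {N : ℕ} {dI dO : Fin N → ℕ} {P : Environment dI dO} :
    IsClassicalProcess P ↔ (∀ i o, 0 ≤ P i o) ∧
      ∀ f : (k : Fin N) → Fin (dI k) → Fin (dO k), ∑ i, P i (fun k => f k (i k)) = 1 := by
  constructor
  · rintro ⟨⟨h0, -⟩, h2⟩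
    refine ⟨h0, fun f => ?_⟩
    let L : (k : Fin N) → LocalIntervention 1 1 (dI k) (dO k) := fun k =>
      { prob := fun _ o _ i => if f k i = o then 1 else 0
        nonneg := fun _ o _ i => by positivity
        sum_one := fun _ i => by simp }
    have h3 : ∑ x, classicalProb P L x (fun _ => 0) = 1 := (h2 1 1 L fun _ => 0).2
    rw [sum_classicalProb] at h3
    rw [← processForm_deterministic]
    simpa [L] using h3
  · rintro ⟨h0, h1⟩
    -- Constant maps recover the normalization of `p(i | o)` at a fixed `o`.
    refine ⟨⟨h0, fun o => h1 fun k _ => o k⟩, fun M D L a => ⟨fun x i o => ?_, ?_⟩⟩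
    · exact mul_nonneg (Finset.prod_nonneg fun k _ => (L k).nonneg _ _ _ _) (h0 _ _)
    · change ∑ x, classicalProb P L x a = 1
      rw [sum_classicalProb]
      refine processForm_eq_one h1 fun k i => ?_
      rw [Finset.sum_comm]
      exact (L k).sum_one _ _

/-- For a deterministic environment the sum in `isClassicalProcess_iff` counts the fixed points of
`i ↦ ω (f i)`. -/
theorem isProcessFunction_iff {N : ℕ} {dI dO : Fin N → ℕ}
    {ω : ((k : Fin N) → Fin (dO k)) → ((k : Fin N) → Fin (dI k))} :
    IsProcessFunction ω ↔ ∀ f : (k : Fin N) → Fin (dI k) → Fin (dO k),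
      ∃! i, i = ω fun k => f k (i k) := by
  rw [IsProcessFunction, isClassicalProcess_iff, and_iff_right]
  · refine forall_congr' fun f => ?_
    simp only [deltaProcess, Finset.sum_boole, Nat.cast_eq_one, Finset.card_eq_one,
      Finset.eq_singleton_iff_unique_mem, Finset.mem_filter, Finset.mem_univ, true_and]
    rfl
  · intro i o
    unfold deltaProcess
    positivity

theorem convex_classicalProcess {N : ℕ} (dI dO : Fin N → ℕ) :
    Convex ℝ {P : Environment dI dO | IsClassicalProcess P} := by
  intro P hP Q hQ s t hs ht hst
  rw [Set.mem_ofPred_eq, isClassicalProcess_iff] at hP hQ ⊢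
  refine ⟨fun i o => ?_, fun f => ?_⟩
  · exact add_nonneg (mul_nonneg hs (hP.1 _ _)) (mul_nonneg ht (hQ.1 _ _))
  · simp only [Pi.add_apply, Pi.smul_apply, smul_eq_mul, Finset.sum_add_distrib,
      ← Finset.mul_sum, hP.2, hQ.2, mul_one, hst]

theorem DC_subset_PC (N M D : ℕ) : DC N M D ⊆ PC N M D := by
  rintro p ⟨dI, dO, hI, hO, P, hP, L, hL⟩
  refine ⟨dI, dO, hI, hO, P, ?_, L, hL⟩
  refine convexHull_min ?_ (convex_classicalProcess dI dO) hP
  rintro _ ⟨ω, hω, rfl⟩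
  exact hω

/-- The correlation realized by a classical process with local interventions. -/
def classicalCorrelation {N M D : ℕ} {dI dO : Fin N → ℕ} {P : Environment dI dO}
    (hP : IsClassicalProcess P) (L : (k : Fin N) → LocalIntervention M D (dI k) (dO k)) :
    Correlation N M D where
  prob x a := classicalProb P L x a
  nonneg x a := by
    rw [classicalProb_eq_processForm]
    exact processForm_nonneg hP.1.1 fun k i o => (L k).nonneg _ _ _ _
  sum_one a := (hP.2 M D L a).2

theorem classicalCorrelation_mem_PC {N M D : ℕ} {dI dO : Fin N → ℕ} (hI : ∀ k, 0 < dI k)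
    (hO : ∀ k, 0 < dO k) {P : Environment dI dO} (hP : IsClassicalProcess P)
    (L : (k : Fin N) → LocalIntervention M D (dI k) (dO k)) :
    classicalCorrelation hP L ∈ PC N M D :=
  ⟨dI, dO, hI, hO, P, hP, L, fun _ _ => rfl⟩

/-- Every correlation is quasi-consistent: the parties announce their settings and receive their
outcomes. -/
theorem mem_qC {N M D : ℕ} (p : Correlation N M D) : p ∈ qC N M D := by
  by_cases hMD : 0 < M ∧ 0 < D
  · refine ⟨fun _ => D, fun _ => M, fun _ => hMD.2, fun _ => hMD.1, fun i o => p.prob i o,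
      ⟨fun i o => p.nonneg i o, fun o => p.sum_one o⟩,
      fun k => ⟨fun x o a i => (if i = x then 1 else 0) * (if a = o then 1 else 0),
        fun x o a i => by positivity, fun a i => by simp⟩, fun x a => ?_⟩
    rw [classicalProb_eq_processForm, processForm_apply, Finset.sum_eq_single x,
      Finset.sum_eq_single a]
    · simp
    · intro o _ ho
      obtain ⟨k, hk⟩ := Function.ne_iff.1 ho
      rw [Finset.prod_eq_zero (Finset.mem_univ k), zero_mul]
      simp [hk.symm]
    · simp
    · intro i _ hi
      obtain ⟨k, hk⟩ := Function.ne_iff.1 hi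
      refine Finset.sum_eq_zero fun o _ => ?_
      rw [Finset.prod_eq_zero (Finset.mem_univ k), zero_mul]
      simp [hk]
    · simp
  -- The degenerate case is separate because the systems must be non-empty. If there is a party,
  -- normalization of `p` excludes `D = 0` with `M > 0`, so `M = 0` and no setting vector exists; if
  -- there is none, `p` is the constant one.
  · have hM : ∀ _ : Fin N, M = 0 := by
      intro k
      rcases Nat.eq_zero_or_pos M with h | h
      · exact h
      have hD : D = 0 := by
        by_contra hD
        exact hMD ⟨h, Nat.pos_of_ne_zero hD⟩
      subst hD
      have := p.sum_one fun _ => ⟨0, h⟩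
      have h0 : IsEmpty (Fin N → Fin 0) := ⟨fun x => (x k).elim0⟩
      rw [Finset.univ_eq_empty, Finset.sum_empty] at this
      exact absurd this zero_ne_one
    refine ⟨fun _ => 1, fun _ => 1, fun _ => one_pos, fun _ => one_pos, fun _ _ => 1,
      ⟨fun _ _ => zero_le_one, fun o => by simp⟩, fun k => ⟨fun _ _ _ _ => 0,
        fun _ _ _ _ => le_rfl, fun a => (Fin.cast (hM k) a).elim0⟩, fun x a => ?_⟩
    rcases Nat.eq_zero_or_pos N with h | h
    · subst h
      rw [classicalProb_eq_processForm, processForm_apply]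
      have := p.sum_one a
      rw [Fintype.sum_unique] at this
      rw [Subsingleton.elim x default, this]
      simp
    · exact (Fin.cast (hM ⟨0, h⟩) (a ⟨0, h⟩)).elim0

/-! ### Bipartite classical processes -/

/-- Changing the section `g` at the single point `j` changes a single summand. -/
theorem eq_of_sum_section_const {ι κ : Type*} [Fintype ι] [DecidableEq ι] {G : ι → κ → ℝ} {c : ℝ}
    (hG : ∀ g : ι → κ, ∑ j, G j (g j) = c) (j : ι) (u u' : κ) : G j u = G j u' := by
  have h1 := hG (Function.update (fun _ => u) j u')
  rw [← hG fun _ => u, ← Finset.add_sum_erase _ _ (Finset.mem_univ j),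
    ← Finset.add_sum_erase _ _ (Finset.mem_univ j), Function.update_self] at h1
  have h2 : ∑ x ∈ Finset.univ.erase j, G x (Function.update (fun _ => u) j u' x) =
      ∑ x ∈ Finset.univ.erase j, G x u :=
    Finset.sum_congr rfl fun x hx => by rw [Function.update_of_ne (Finset.ne_of_mem_erase hx)]
  linarith

/-- A logically consistent bipartite environment is a sum of two environments without
signalling in one of the two directions. -/
theorem exists_ordered_decomposition {ι₀ ι₁ κ₀ κ₁ : Type*} [Fintype ι₀] [DecidableEq ι₀]
    [Fintype ι₁] [DecidableEq ι₁] [Fintype κ₀] [Nonempty κ₀] [Nonempty κ₁]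
    (Q : ι₀ → ι₁ → κ₀ → κ₁ → ℝ) (h0 : ∀ i j o u, 0 ≤ Q i j o u)
    (h1 : ∀ (f : ι₀ → κ₀) (g : ι₁ → κ₁), ∑ i, ∑ j, Q i j (f i) (g j) = 1) :
    ∃ (α : ι₀ → ι₁ → κ₀ → ℝ) (β : ι₀ → ι₁ → κ₁ → ℝ) (a : ι₀ → ℝ) (b : ι₁ → ℝ),
      (∀ i j o, 0 ≤ α i j o) ∧ (∀ i j u, 0 ≤ β i j u) ∧
      (∀ i j o u, Q i j o u = α i j o + β i j u) ∧
      (∀ i o, ∑ j, α i j o = a i) ∧ (∀ j u, ∑ i, β i j u = b j) ∧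
      ∑ i, a i + ∑ j, b j = 1 := by
  have hs0 : ∀ (g : ι₁ → κ₁) i o o', ∑ j, Q i j o (g j) = ∑ j, Q i j o' (g j) := fun g =>
    eq_of_sum_section_const (G := fun i o => ∑ j, Q i j o (g j)) (fun f => h1 f g)
  have hs1 : ∀ (f : ι₀ → κ₀) j u u', ∑ i, Q i j (f i) u = ∑ i, Q i j (f i) u' := fun f =>
    eq_of_sum_section_const (G := fun j u => ∑ i, Q i j (f i) u) (c := 1)
      (fun g => by rw [← h1 f g, Finset.sum_comm])
  -- By `hs0` the differences in `o` sum to zero along every section `g`, so each difference is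
  -- independent of `u`: the dependence on the two outputs is additive.
  have hadd : ∀ i o o' j u u', Q i j o u - Q i j o' u = Q i j o u' - Q i j o' u' :=
    fun i o o' => eq_of_sum_section_const (G := fun j u => Q i j o u - Q i j o' u) (c := 0)
      (fun g => by rw [Finset.sum_sub_distrib, hs0 g i o o', sub_self])
  obtain ⟨o₀⟩ := ‹Nonempty κ₀›
  obtain ⟨u₀⟩ := ‹Nonempty κ₁›
  -- Subtracting the minimum over `o` leaves a nonnegative `α`, while `β` is `Q` at a minimizer and
  -- hence nonnegative as well.
  have hmin : ∀ i j, ∃ o, ∀ o', Q i j o u₀ ≤ Q i j o' u₀ := fun i j => by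
    obtain ⟨o, -, ho⟩ := Finset.exists_min_image Finset.univ (fun o => Q i j o u₀) ⟨o₀, by simp⟩
    exact ⟨o, fun o' => ho o' (Finset.mem_univ _)⟩
  choose m hm using hmin
  -- The minimizer depends on `j`, but for fixed `j` it is a map of `i` alone, so `hs1` applies to
  -- it and gives the normalization of `β`.
  refine ⟨fun i j o => Q i j o u₀ - Q i j (m i j) u₀, fun i j u => Q i j (m i j) u,
    fun i => ∑ j, (Q i j o₀ u₀ - Q i j (m i j) u₀), fun j => ∑ i, Q i j (m i j) u₀,
    fun i j o => sub_nonneg.2 (hm i j o), fun i j u => h0 _ _ _ _, fun i j o u => ?_,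
    fun i o => ?_, fun j u => hs1 (fun i => m i j) j u u₀, ?_⟩
  · linarith [hadd i o (m i j) j u u₀]
  · simp only [Finset.sum_sub_distrib]
    rw [hs0 (fun _ => u₀) i o o₀]
  · have hc : ∑ j, ∑ i, Q i j (m i j) u₀ = ∑ i, ∑ j, Q i j (m i j) u₀ := Finset.sum_comm
    simp only [Finset.sum_sub_distrib]
    rw [hc, sub_add_cancel]
    exact h1 (fun _ => o₀) fun _ => u₀

/-- The section weights `a (∏ o, A o (g o) / a)` of nonnegative vectors `A o` of common sum `a`. -/
theorem exists_section_weights {κ ι : Type*} [Fintype κ] [DecidableEq κ] [Fintype ι]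
    [DecidableEq ι] (A : κ → ι → ℝ) (a : ℝ) (hA : ∀ o j, 0 ≤ A o j) (ha : ∀ o, ∑ j, A o j = a)
    (ha0 : 0 ≤ a) : ∃ w : (κ → ι) → ℝ, (∀ g, 0 ≤ w g) ∧ ∑ g, w g = a ∧
      ∀ o j, ∑ g, w g * (if g o = j then 1 else 0) = A o j := by
  rcases ha0.eq_or_lt with h | h
  · refine ⟨0, fun _ => le_rfl, by simpa using h, fun o j => ?_⟩
    have h2 := ha o
    rw [← h, Finset.sum_eq_zero_iff_of_nonneg fun j _ => hA o j] at h2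
    simp [h2 j (Finset.mem_univ j)]
  · have hC : ∀ o, ∑ j, A o j / a = 1 := fun o => by
      rw [← Finset.sum_div, ha, div_self h.ne']
    refine ⟨fun g => a * ∏ o, A o (g o) / a, fun g => ?_, ?_, fun o j => ?_⟩
    · exact mul_nonneg ha0 (Finset.prod_nonneg fun o _ => div_nonneg (hA _ _) ha0)
    · rw [← Finset.mul_sum, sum_prod_eq_one (fun o j => A o j / a) hC, mul_one]
    · simp_rw [mul_assoc]
      rw [← Finset.mul_sum, sum_prod_mul_indicator (fun o j => A o j / a) hC,
        mul_div_cancel₀ _ h.ne']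

/-- The pair of variables of two parties as a family. -/
def pairVar {d : Fin 2 → ℕ} (i : Fin (d 0)) (j : Fin (d 1)) : (k : Fin 2) → Fin (d k) :=
  (piFinTwoEquiv fun k => Fin (d k)).symm (i, j)

@[simp] theorem pairVar_zero {d : Fin 2 → ℕ} (i : Fin (d 0)) (j : Fin (d 1)) :
    pairVar i j 0 = i := rfl

@[simp] theorem pairVar_one {d : Fin 2 → ℕ} (i : Fin (d 0)) (j : Fin (d 1)) :
    pairVar i j 1 = j := rfl

theorem pairVar_eta {d : Fin 2 → ℕ} (i : (k : Fin 2) → Fin (d k)) : pairVar (i 0) (i 1) = i :=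
  (piFinTwoEquiv fun k => Fin (d k)).symm_apply_apply i

theorem eq_pairVar_iff {d : Fin 2 → ℕ} {i : (k : Fin 2) → Fin (d k)} {x : Fin (d 0)}
    {y : Fin (d 1)} : i = pairVar x y ↔ i 0 = x ∧ i 1 = y := by
  constructor
  · rintro rfl
    exact ⟨rfl, rfl⟩
  · rintro ⟨rfl, rfl⟩
    exact (pairVar_eta i).symm

theorem sum_pairVar {d : Fin 2 → ℕ} (F : ((k : Fin 2) → Fin (d k)) → ℝ) :
    ∑ i, F i = ∑ i, ∑ j, F (pairVar i j) := by
  rw [← Fintype.sum_prod_type']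
  exact Fintype.sum_equiv (piFinTwoEquiv fun k => Fin (d k)) _ _ fun i => by
    rw [← pairVar_eta i]; rfl

theorem exists_ordered_decomposition_of_isClassicalProcess {dI dO : Fin 2 → ℕ}
    (hO : ∀ k, 0 < dO k) {P : Environment dI dO} (hP : IsClassicalProcess P) :
    ∃ (α : Fin (dI 0) → Fin (dI 1) → Fin (dO 0) → ℝ)
      (β : Fin (dI 0) → Fin (dI 1) → Fin (dO 1) → ℝ) (a : Fin (dI 0) → ℝ) (b : Fin (dI 1) → ℝ),
      (∀ i j o, 0 ≤ α i j o) ∧ (∀ i j u, 0 ≤ β i j u) ∧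
      (∀ i o, P i o = α (i 0) (i 1) (o 0) + β (i 0) (i 1) (o 1)) ∧
      (∀ i o, ∑ j, α i j o = a i) ∧ (∀ j u, ∑ i, β i j u = b j) ∧
      ∑ i, a i + ∑ j, b j = 1 := by
  rw [isClassicalProcess_iff] at hP
  have : Nonempty (Fin (dO 0)) := ⟨⟨0, hO 0⟩⟩
  have : Nonempty (Fin (dO 1)) := ⟨⟨0, hO 1⟩⟩
  obtain ⟨α, β, a, b, h1, h2, h3, h4⟩ := exists_ordered_decomposition
    (fun i j o u => P (pairVar i j) (pairVar o u)) (fun _ _ _ _ => hP.1 _ _) (fun f g => by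
      rw [← hP.2 (Fin.cons f (Fin.cons g finZeroElim)), sum_pairVar]
      refine Finset.sum_congr rfl fun i _ => Finset.sum_congr rfl fun j _ => ?_
      congr 1
      symm
      rw [eq_pairVar_iff]
      exact ⟨rfl, rfl⟩)
  refine ⟨α, β, a, b, h1, h2, fun i o => ?_, h4⟩
  rw [← h3, pairVar_eta, pairVar_eta]

/-- The fixed-point equation is solved in causal order: the input of party `0` is given, and its
output determines the input of party `1`. -/
theorem isProcessFunction_pairVar_left {dI dO : Fin 2 → ℕ} (i : Fin (dI 0))
    (g : Fin (dO 0) → Fin (dI 1)) :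
    IsProcessFunction (dI := dI) (dO := dO) fun o => pairVar i (g (o 0)) := by
  rw [isProcessFunction_iff]
  refine fun f => ⟨pairVar i (g (f 0 i)), rfl, fun y hy => ?_⟩
  obtain ⟨h0, h1⟩ := eq_pairVar_iff.1 hy
  exact hy.trans (congrArg (fun v => pairVar i (g (f 0 v))) h0)

theorem isProcessFunction_pairVar_right {dI dO : Fin 2 → ℕ} (j : Fin (dI 1))
    (g : Fin (dO 1) → Fin (dI 0)) :
    IsProcessFunction (dI := dI) (dO := dO) fun o => pairVar (g (o 1)) j := by
  rw [isProcessFunction_iff]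
  refine fun f => ⟨pairVar (g (f 1 j)) j, rfl, fun y hy => ?_⟩
  obtain ⟨h0, h1⟩ := eq_pairVar_iff.1 hy
  exact hy.trans (congrArg (fun v => pairVar (g (f 1 v)) j) h1)

/-- In the part where party `0` comes first, the vectors `α i · o` for a fixed input `i` have a
common sum, so they are a mixture of sections `g` from its outputs to the inputs of party `1`. Each
pair `(i, g)` is a process function. The other part is symmetric, and all weights together sum to
one. -/
theorem mem_detExtremaPolytope_of_isClassicalProcess {dI dO : Fin 2 → ℕ} (hO : ∀ k, 0 < dO k)
    {P : Environment dI dO} (hP : IsClassicalProcess P) : P ∈ detExtremaPolytope dI dO := by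
  obtain ⟨α, β, a, b, hα, hβ, hsum, ha, hb, hab⟩ :=
    exists_ordered_decomposition_of_isClassicalProcess hO hP
  have ha0 : ∀ i, 0 ≤ a i := fun i => by
    rw [← ha i ⟨0, hO 0⟩]
    exact Finset.sum_nonneg fun j _ => hα _ _ _
  have hb0 : ∀ i, 0 ≤ b i := fun i => by
    rw [← hb i ⟨0, hO 1⟩]
    exact Finset.sum_nonneg fun j _ => hβ _ _ _
  choose w hw0 hw1 hw using fun i =>
    exists_section_weights (fun o j => α i j o) (a i) (fun _ _ => hα _ _ _) (ha i) (ha0 i)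
  choose v hv0 hv1 hv using fun j =>
    exists_section_weights (fun u i => β i j u) (b j) (fun _ _ => hβ _ _ _) (hb j) (hb0 j)
  let z : (Fin (dI 0) × (Fin (dO 0) → Fin (dI 1))) ⊕ (Fin (dI 1) × (Fin (dO 1) → Fin (dI 0))) →
      Environment dI dO := Sum.elim (fun s => deltaProcess fun o => pairVar s.1 (s.2 (o 0)))
    fun s => deltaProcess fun o => pairVar (s.2 (o 1)) s.1
  let c : (Fin (dI 0) × (Fin (dO 0) → Fin (dI 1))) ⊕ (Fin (dI 1) × (Fin (dO 1) → Fin (dI 0))) →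
      ℝ := Sum.elim (fun s => w s.1 s.2) fun s => v s.1 s.2
  have hz : P = ∑ s, c s • z s := by
    funext i o
    rw [hsum, Fintype.sum_sum_type]
    simp only [c, z, Sum.elim_inl, Sum.elim_inr, Pi.add_apply, Finset.sum_apply, Pi.smul_apply,
      smul_eq_mul, deltaProcess, eq_pairVar_iff, Fintype.sum_prod_type]
    congr 1
    · rw [Finset.sum_eq_single (i 0), ← hw]
      · simp [eq_comm]
      · intro j _ hj
        simp [hj.symm]
      · simp
    · rw [Finset.sum_eq_single (i 1), ← hv]
      · simp [eq_comm]
      · intro j _ hj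
        simp [hj.symm]
      · simp
  rw [hz]
  refine (convex_convexHull ℝ _).sum_mem ?_ ?_ ?_
  · rintro (s | s) -
    · exact hw0 _ _
    · exact hv0 _ _
  · rw [Fintype.sum_sum_type, Fintype.sum_prod_type, Fintype.sum_prod_type, ← hab]
    simp only [c, Sum.elim_inl, Sum.elim_inr, hw1, hv1]
  · rintro (s | s) -
    · exact subset_convexHull ℝ _ ⟨_, isProcessFunction_pairVar_left _ _, rfl⟩
    · exact subset_convexHull ℝ _ ⟨_, isProcessFunction_pairVar_right _ _, rfl⟩

theorem DC_two_eq_PC_two (M D : ℕ) : DC 2 M D = PC 2 M D := by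
  refine (DC_subset_PC 2 M D).antisymm ?_
  rintro p ⟨dI, dO, hI, hO, P, hP, L, hL⟩
  exact ⟨dI, dO, hI, hO, P, mem_detExtremaPolytope_of_isClassicalProcess hO hP, L, hL⟩

/-- A one-party correlation. -/
def Correlation.single {M D : ℕ} (f : Fin D → Fin M → ℝ) (h0 : ∀ x a, 0 ≤ f x a)
    (h1 : ∀ a, ∑ x, f x a = 1) : Correlation 1 M D where
  prob x a := f (x 0) (a 0)
  nonneg _ _ := h0 _ _
  sum_one a := by
    rw [← h1 (a 0)]
    exact Fintype.sum_equiv (Equiv.funUnique (Fin 1) (Fin D)) _ _ fun x => rfl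

theorem nonempty_correlation_one {N M D : ℕ} (p : Correlation (N + 1) M D) :
    Nonempty (Correlation 1 M D) := by
  rcases Nat.eq_zero_or_pos D with rfl | hD
  · refine ⟨Correlation.single (fun _ _ => 0) (fun _ _ => le_rfl) fun a => ?_⟩
    have := p.sum_one fun _ => a
    rw [Finset.univ_eq_empty, Finset.sum_empty] at this
    exact absurd this zero_ne_one
  · exact ⟨Correlation.single (fun x _ => if x = ⟨0, hD⟩ then 1 else 0)
      (fun _ _ => by positivity) (fun a => by simp)⟩

/-- Local interventions in a one-way signalling environment realize one-way signalling
correlations. -/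
theorem exists_ordered_correlations {M D dI₀ dI₁ dO₀ dO₁ : ℕ} (p : Correlation 1 M D)
    (hO : 0 < dO₀) {α : Fin dI₀ → Fin dI₁ → Fin dO₀ → ℝ} {a : Fin dI₀ → ℝ}
    (hα : ∀ i j o, 0 ≤ α i j o) (ha : ∀ i o, ∑ j, α i j o = a i)
    (L₀ : LocalIntervention M D dI₀ dO₀) (L₁ : LocalIntervention M D dI₁ dO₁) :
    ∃ (r : Correlation 1 M D) (s : Fin D → Fin M → Correlation 1 M D), ∀ x c y d,
      (∑ i, a i) * r.prob (fun _ => x) (fun _ => c) * (s x c).prob y d =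
        ∑ i, ∑ o, ∑ j, ∑ u, L₀.prob x o c i * L₁.prob (y 0) u (d 0) j * α i j o := by
  have ha0 : ∀ i, 0 ≤ a i := fun i => by
    rw [← ha i ⟨0, hO⟩]
    exact Finset.sum_nonneg fun j _ => hα _ _ _
  let T : Fin D → Fin M → Fin D → Fin M → ℝ := fun x c y d =>
    ∑ i, ∑ o, ∑ j, ∑ u, L₀.prob x o c i * L₁.prob y u d j * α i j o
  let R : Fin D → Fin M → ℝ := fun x c => ∑ i, ∑ o, L₀.prob x o c i * a i
  have hT0 : ∀ x c y d, 0 ≤ T x c y d := fun x c y d =>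
    Finset.sum_nonneg fun i _ => Finset.sum_nonneg fun o _ => Finset.sum_nonneg fun j _ =>
      Finset.sum_nonneg fun u _ =>
        mul_nonneg (mul_nonneg (L₀.nonneg _ _ _ _) (L₁.nonneg _ _ _ _)) (hα _ _ _)
  have hR0 : ∀ x c, 0 ≤ R x c := fun x c =>
    Finset.sum_nonneg fun i _ => Finset.sum_nonneg fun o _ =>
      mul_nonneg (L₀.nonneg _ _ _ _) (ha0 _)
  -- `T` is the unnormalized joint distribution and `R` that of the first party alone. The marginal
  -- does not see `d` because `α` has the marginal `a i` whatever the output `o`.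
  have hTR : ∀ x c d, ∑ y, T x c y d = R x c := fun x c d => by
    simp only [T, R]
    rw [Finset.sum_comm]
    refine Finset.sum_congr rfl fun i _ => ?_
    rw [Finset.sum_comm]
    refine Finset.sum_congr rfl fun o _ => ?_
    rw [Finset.sum_comm, ← ha i o, Finset.mul_sum]
    refine Finset.sum_congr rfl fun j _ => ?_
    simp_rw [mul_right_comm _ _ (α i j o)]
    simp_rw [← Finset.mul_sum]
    rw [L₁.sum_one, mul_one]
  have hRq : ∀ c, ∑ x, R x c = ∑ i, a i := fun c => by
    simp only [R]
    rw [Finset.sum_comm]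
    refine Finset.sum_congr rfl fun i _ => ?_
    simp_rw [← Finset.sum_mul]
    rw [L₀.sum_one, one_mul]
  -- The factors are the normalized marginal `R / ∑ a` and the conditional `T / R`. Where a
  -- denominator vanishes so does the numerator, and the arbitrary correlation `p` is inserted.
  have hr : ∃ r : Correlation 1 M D, ∀ x c,
      (∑ i, a i) * r.prob (fun _ => x) (fun _ => c) = R x c := by
    rcases (Finset.sum_nonneg fun i _ => ha0 i : 0 ≤ ∑ i, a i).eq_or_lt with h | h
    · refine ⟨p, fun x c => ?_⟩
      have h2 := hRq c
      rw [← h, Finset.sum_eq_zero_iff_of_nonneg fun x _ => hR0 x c] at h2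
      rw [← h, zero_mul, h2 x (Finset.mem_univ _)]
    · refine ⟨Correlation.single (fun x c => R x c / ∑ i, a i)
        (fun x c => div_nonneg (hR0 _ _) h.le) (fun c => ?_), fun x c => ?_⟩
      · rw [← Finset.sum_div, hRq, div_self h.ne']
      · exact mul_div_cancel₀ _ h.ne'
  have hs : ∀ x c, ∃ s : Correlation 1 M D, ∀ y d, R x c * s.prob y d = T x c (y 0) (d 0) := by
    intro x c
    rcases (hR0 x c).eq_or_lt with h | h
    · refine ⟨p, fun y d => ?_⟩
      have h2 := hTR x c (d 0)
      rw [← h, Finset.sum_eq_zero_iff_of_nonneg fun y _ => hT0 x c y _] at h2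
      rw [← h, zero_mul, h2 _ (Finset.mem_univ _)]
    · refine ⟨Correlation.single (fun y d => T x c y d / R x c)
        (fun y d => div_nonneg (hT0 _ _ _ _) h.le) (fun d => ?_), fun y d => ?_⟩
      · rw [← Finset.sum_div, hTR, div_self h.ne']
      · exact mul_div_cancel₀ _ h.ne'
  obtain ⟨r, hr⟩ := hr
  choose s hs using hs
  exact ⟨r, s, fun x c y d => by rw [hr, hs]⟩

/-- The two one-way signalling parts are the two causal orders, with weights `∑ a` and `∑ b`. -/
theorem isCausal_of_mem_PC_two {M D : ℕ} {p : Correlation 2 M D} (hp : p ∈ PC 2 M D) :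
    IsCausal p := by
  obtain ⟨dI, dO, hI, hO, P, hP, L, hL⟩ := hp
  obtain ⟨α, β, a, b, hα, hβ, hsum, ha, hb, hab⟩ :=
    exists_ordered_decomposition_of_isClassicalProcess hO hP
  obtain ⟨c⟩ := nonempty_correlation_one p
  obtain ⟨r₀, s₀, h₀⟩ := exists_ordered_correlations c (hO 0) hα ha (L 0) (L 1)
  obtain ⟨r₁, s₁, h₁⟩ := exists_ordered_correlations c (hO 1) (α := fun j i u => β i j u)
    (fun _ _ _ => hβ _ _ _) hb (L 1) (L 0)
  refine ⟨![∑ i, a i, ∑ j, b j], ![r₀, r₁], ![s₀, s₁], ?_, ?_, fun _ _ _ => trivial, ?_⟩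
  · refine Fin.forall_fin_two.2 ⟨?_, ?_⟩
    · change 0 ≤ ∑ i, a i
      refine Finset.sum_nonneg fun i _ => ?_
      rw [← ha i ⟨0, hO 0⟩]
      exact Finset.sum_nonneg fun j _ => hα _ _ _
    · change 0 ≤ ∑ j, b j
      refine Finset.sum_nonneg fun i _ => ?_
      rw [← hb i ⟨0, hO 1⟩]
      exact Finset.sum_nonneg fun j _ => hβ _ _ _
  · simpa using hab
  · intro x y
    rw [hL, classicalProb_eq_processForm, processForm_apply, Fin.sum_univ_two]
    simp only [Matrix.cons_val_zero, Matrix.cons_val_one]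
    rw [h₀, h₁, sum_pairVar]
    simp_rw [sum_pairVar, Fin.prod_univ_two, hsum, pairVar_zero, pairVar_one, mul_add,
      Finset.sum_add_distrib]
    congr 1
    · refine Finset.sum_congr rfl fun i _ => ?_
      rw [Finset.sum_comm]
      rfl
    · rw [Finset.sum_comm]
      refine Finset.sum_congr rfl fun j _ => ?_
      conv_rhs => rw [Finset.sum_comm]
      refine Finset.sum_congr rfl fun i _ => ?_
      rw [Finset.sum_comm]
      refine Finset.sum_congr rfl fun u _ => Finset.sum_congr rfl fun o _ => ?_
      rw [mul_comm ((L 0).prob _ _ _ _)]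
      rfl

/-! ### The bipartite causal inequalities -/

theorem sum_fin_two_fun {α β : Type*} [Fintype α] [AddCommMonoid β] (F : (Fin 2 → α) → β) :
    ∑ x, F x = ∑ x, ∑ y, F ![x, y] := by
  rw [← Fintype.sum_prod_type']
  refine Fintype.sum_equiv (finTwoArrowEquiv α) _ _ fun x => ?_
  congr 1
  ext k
  fin_cases k <;> rfl

theorem Correlation.sum_single {M D : ℕ} (p : Correlation 1 M D) (a : Fin 1 → Fin M) :
    ∑ x, p.prob (fun _ => x) a = 1 := by
  rw [← p.sum_one a]
  exact (Fintype.sum_equiv (Equiv.funUnique (Fin 1) (Fin D)) _ _ fun x => by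
    congr 1; funext k; rw [Subsingleton.elim k default]; rfl).symm

/-- For two parties the recursion bottoms out in one-party correlations, so causality becomes a
statement about arrays and the inequalities become linear arithmetic. -/
theorem IsCausal.exists_two {M D : ℕ} {p : Correlation 2 M D} (hp : IsCausal p) :
    ∃ (t : ℝ) (R R' : Fin D → Fin M → ℝ) (S S' : Fin D → Fin M → Fin D → Fin M → ℝ),
      0 ≤ t ∧ t ≤ 1 ∧ (∀ x a, 0 ≤ R x a) ∧ (∀ x a, 0 ≤ R' x a) ∧
      (∀ a, ∑ x, R x a = 1) ∧ (∀ a, ∑ x, R' x a = 1) ∧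
      (∀ x a y b, 0 ≤ S x a y b) ∧ (∀ x a y b, 0 ≤ S' x a y b) ∧
      (∀ x a b, ∑ y, S x a y b = 1) ∧ (∀ x a b, ∑ y, S' x a y b = 1) ∧
      ∀ x y a b, p.prob ![x, y] ![a, b] =
        t * (R x a * S x a y b) + (1 - t) * (R' y b * S' y b x a) := by
  obtain ⟨q, r, s, hq, hq1, -, h⟩ := hp
  rw [Fin.sum_univ_two] at hq1
  refine ⟨q 0, fun x a => (r 0).prob (fun _ => x) (fun _ => a),
    fun x a => (r 1).prob (fun _ => x) (fun _ => a),
    fun x a y b => (s 0 x a).prob (fun _ => y) (fun _ => b),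
    fun x a y b => (s 1 x a).prob (fun _ => y) (fun _ => b), hq 0, by linarith [hq 1],
    fun _ _ => Correlation.nonneg _ _ _, fun _ _ => Correlation.nonneg _ _ _,
    fun _ => Correlation.sum_single _ _, fun _ => Correlation.sum_single _ _,
    fun _ _ _ _ => Correlation.nonneg _ _ _, fun _ _ _ _ => Correlation.nonneg _ _ _,
    fun _ _ _ => Correlation.sum_single _ _, fun _ _ _ => Correlation.sum_single _ _,
    fun x y a b => ?_⟩
  have h0 : ∀ {α : Type} (x y : α), (0 : Fin 2).removeNth ![x, y] = fun _ => y := by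
    intro α x y
    funext k
    rw [Subsingleton.elim k 0]
    rfl
  have h1 : ∀ {α : Type} (x y : α), (1 : Fin 2).removeNth ![x, y] = fun _ => x := by
    intro α x y
    funext k
    rw [Subsingleton.elim k 0]
    rfl
  rw [h, Fin.sum_univ_two, h0, h0, h1, h1, show (1 : ℝ) - q 0 = q 1 by linarith, mul_assoc,
    mul_assoc]
  rfl

theorem gyni_eq (p : Correlation 2 2 2) :
    gyni p = 1 / 4 * (p.prob ![0, 0] ![0, 0] + p.prob ![1, 0] ![0, 1] + p.prob ![0, 1] ![1, 0] +
      p.prob ![1, 1] ![1, 1]) := by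
  simp [gyni, sum_fin_two_fun, Fin.sum_univ_two]
  ring

/-- A party with setting `0` has nothing to guess, so the settings `(0, 0)` are always won and
contribute the summand one. -/
theorem lgyni_eq (p : Correlation 2 2 2) :
    lgyni p = 1 / 4 * (1 + (p.prob ![0, 0] ![0, 1] + p.prob ![1, 0] ![0, 1]) +
      (p.prob ![0, 0] ![1, 0] + p.prob ![0, 1] ![1, 0]) + p.prob ![1, 1] ![1, 1]) := by
  have h1 := p.sum_one ![0, 0]
  simp only [sum_fin_two_fun, Fin.sum_univ_two] at h1
  simp [lgyni, sum_fin_two_fun, Fin.sum_univ_two]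
  linarith

/-- In a fixed order, the first party's outcome is independent of the other setting, so for each of
its own settings its two successful guesses have total probability at most one. This gives at most
two of four in the first game. In the lazy game the settings `(0, 0)` give one, the case where only
the second party guesses gives at most one, and the two cases where the first party guesses give at
most one together. -/
theorem causal_inequalities {p : Correlation 2 2 2} (hp : IsCausal p) :
    gyni p ≤ 1 / 2 ∧ lgyni p ≤ 3 / 4 := by
  obtain ⟨t, R, R', S, S', ht0, ht1, hR, hR', hR1, hR1', hS, hS', hS1, hS1', h⟩ := hp.exists_two
  simp only [Fin.sum_univ_two] at hR1 hR1' hS1 hS1'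
  have hle : ∀ x a y b, R x a * S x a y b ≤ R x a := fun x a y b =>
    mul_le_of_le_one_right (hR x a) (by
      have := hS1 x a b
      have h0 := hS x a 0 b
      have h1 := hS x a 1 b
      fin_cases y <;> simp only [Fin.zero_eta, Fin.mk_one] <;> linarith)
  have hle' : ∀ x a y b, R' x a * S' x a y b ≤ R' x a := fun x a y b =>
    mul_le_of_le_one_right (hR' x a) (by
      have := hS1' x a b
      have h0 := hS' x a 0 b
      have h1 := hS' x a 1 b
      fin_cases y <;> simp only [Fin.zero_eta, Fin.mk_one] <;> linarith)
  have hsum : ∀ x a b, R x a * S x a 0 b + R x a * S x a 1 b = R x a := fun x a b => by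
    rw [← mul_add, hS1, mul_one]
  have hsum' : ∀ x a b, R' x a * S' x a 0 b + R' x a * S' x a 1 b = R' x a := fun x a b => by
    rw [← mul_add, hS1', mul_one]
  have mix : ∀ u v c : ℝ, u ≤ c → v ≤ c → t * u + (1 - t) * v ≤ c := fun u v c hu hv => by
    nlinarith [mul_le_mul_of_nonneg_left hu ht0,
      mul_le_mul_of_nonneg_left hv (sub_nonneg.2 ht1)]
  constructor
  · rw [gyni_eq]
    simp only [h]
    have := mix (R 0 0 * S 0 0 0 0 + R 1 0 * S 1 0 0 1 + R 0 1 * S 0 1 1 0 + R 1 1 * S 1 1 1 1)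
      (R' 0 0 * S' 0 0 0 0 + R' 0 1 * S' 0 1 1 0 + R' 1 0 * S' 1 0 0 1 + R' 1 1 * S' 1 1 1 1) 2
      (by linarith [hle 0 0 0 0, hle 1 0 0 1, hle 0 1 1 0, hle 1 1 1 1, hR1 0, hR1 1])
      (by linarith [hle' 0 0 0 0, hle' 0 1 1 0, hle' 1 0 0 1, hle' 1 1 1 1, hR1' 0, hR1' 1])
    linarith
  · rw [lgyni_eq]
    simp only [h]
    have := mix (R 0 0 * S 0 0 0 1 + R 1 0 * S 1 0 0 1 + (R 0 1 * S 0 1 0 0 + R 0 1 * S 0 1 1 0) +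
        R 1 1 * S 1 1 1 1)
      (R' 0 1 * S' 0 1 0 0 + R' 0 1 * S' 0 1 1 0 + (R' 0 0 * S' 0 0 0 1 + R' 1 0 * S' 1 0 0 1) +
        R' 1 1 * S' 1 1 1 1) 2
      (by linarith [hle 0 0 0 1, hle 1 0 0 1, hsum 0 1 0, hle 1 1 1 1, hR1 0, hR1 1])
      (by linarith [hle' 0 0 0 1, hle' 1 0 0 1, hsum' 0 1 0, hle' 1 1 1 1, hR1' 0, hR1' 1])
    linarith

/-! ### Process matrices as multilinear forms -/

/-- The form `A ↦ Tr (W ⨂_k A_k)`. -/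
def quantumForm {N : ℕ} {dI dO : Fin N → ℕ} (W : GlobalOperator dI dO) :
    MultilinearMap ℂ
      (fun k => Matrix (Fin (dI k) × Fin (dO k)) (Fin (dI k) × Fin (dO k)) ℂ) ℂ :=
  ∑ s, ∑ t, W s t • (MultilinearMap.mkPiAlgebra ℂ (Fin N) ℂ).compLinearMap
    fun k => Matrix.entryLinearMap ℂ ℂ (t k) (s k)

theorem quantumForm_apply {N : ℕ} {dI dO : Fin N → ℕ} (W : GlobalOperator dI dO)
    (A : (k : Fin N) → Matrix (Fin (dI k) × Fin (dO k)) (Fin (dI k) × Fin (dO k)) ℂ) :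
    quantumForm W A = (W * tensorOperator A).trace := by
  simp [quantumForm, Matrix.trace, Matrix.mul_apply, tensorOperator]

theorem trace_mul_nonneg {n : Type*} [Fintype n] {A B : Matrix n n ℂ} (hA : A.PosSemidef)
    (hB : B.PosSemidef) : 0 ≤ (A * B).trace := by
  obtain ⟨m, v, rfl⟩ := Matrix.posSemidef_iff_eq_sum_vecMulVec.1 hB
  rw [Matrix.mul_sum, Matrix.trace_sum]
  refine Finset.sum_nonneg fun i _ => ?_
  rw [Matrix.mul_vecMulVec, Matrix.trace_vecMulVec, dotProduct_comm]
  exact hA.dotProduct_mulVec_nonneg _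

/-- Each factor is a sum of rank-one operators, and the product of rank-one operators is the
rank-one operator of the product vector. -/
theorem posSemidef_tensorOperator {N : ℕ} {dI dO : Fin N → ℕ}
    {A : (k : Fin N) → Matrix (Fin (dI k) × Fin (dO k)) (Fin (dI k) × Fin (dO k)) ℂ}
    (hA : ∀ k, (A k).PosSemidef) : (tensorOperator A).PosSemidef := by
  choose m v hv using fun k => Matrix.posSemidef_iff_eq_sum_vecMulVec.1 (hA k)
  have : tensorOperator A = ∑ p : (k : Fin N) → Fin (m k),
      Matrix.vecMulVec (fun s : (k : Fin N) → Fin (dI k) × Fin (dO k) => ∏ k, v k (p k) (s k))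
        (star fun s : (k : Fin N) → Fin (dI k) × Fin (dO k) => ∏ k, v k (p k) (s k)) := by
    ext s t
    simp only [tensorOperator, Matrix.of_apply, Matrix.sum_apply, Matrix.vecMulVec_apply,
      Pi.star_apply, star_prod, ← Finset.prod_mul_distrib]
    rw [← Fintype.piFinset_univ, ← Finset.prod_univ_sum (fun _ => Finset.univ)
      fun k j => v k j (s k) * star (v k j (t k))]
    refine Finset.prod_congr rfl fun k _ => ?_
    conv_lhs => rw [hv k]
    simp [Matrix.sum_apply, Matrix.vecMulVec_apply]
  rw [this]
  exact Matrix.posSemidef_sum _ fun p _ => Matrix.posSemidef_vecMulVec_self_star _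

theorem quantumForm_nonneg {N : ℕ} {dI dO : Fin N → ℕ} {W : GlobalOperator dI dO}
    (hW : W.PosSemidef)
    {A : (k : Fin N) → Matrix (Fin (dI k) × Fin (dO k)) (Fin (dI k) × Fin (dO k)) ℂ}
    (hA : ∀ k, (A k).PosSemidef) : 0 ≤ quantumForm W A := by
  rw [quantumForm_apply]
  exact trace_mul_nonneg hW (posSemidef_tensorOperator hA)

theorem quantumForm_eq_one {N : ℕ} {dI dO : Fin N → ℕ} {W : GlobalOperator dI dO}
    (hW : IsProcessMatrix W)
    {A : (k : Fin N) → Matrix (Fin (dI k) × Fin (dO k)) (Fin (dI k) × Fin (dO k)) ℂ}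
    (hA : ∀ k, (A k).PosSemidef) (hA1 : ∀ k, traceOut (A k) = 1) : quantumForm W A = 1 := by
  rw [quantumForm_apply]
  exact hW.2 A fun k => ⟨hA k, hA1 k⟩

theorem quantumProb_eq_quantumForm {N M D : ℕ} {dI dO : Fin N → ℕ} (W : GlobalOperator dI dO)
    (Φ : (k : Fin N) → Fin M → Fin D →
      (Matrix (Fin (dI k)) (Fin (dI k)) ℂ →ₗ[ℂ] Matrix (Fin (dO k)) (Fin (dO k)) ℂ))
    (x : Fin N → Fin D) (a : Fin N → Fin M) :
    quantumProb W Φ x a = quantumForm W fun k => choiMatrix (Φ k (a k) (x k)) :=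
  (quantumForm_apply _ _).symm

/-! ### Instruments -/

theorem unnormalizedMaxEntangled_eq (d : ℕ) : unnormalizedMaxEntangled d =
    Matrix.vecMulVec (fun s => if s.1 = s.2 then 1 else 0)
      (star fun s => if s.1 = s.2 then 1 else 0) := by
  ext s t
  by_cases h : s.1 = s.2 <;> by_cases h' : t.1 = t.2 <;>
    simp [unnormalizedMaxEntangled, Matrix.vecMulVec_apply, h, h']

theorem IsCompletelyPositive.posSemidef_choiMatrix {dI dO : ℕ}
    {Φ : Matrix (Fin dI) (Fin dI) ℂ →ₗ[ℂ] Matrix (Fin dO) (Fin dO) ℂ}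
    (hΦ : IsCompletelyPositive Φ) : (choiMatrix Φ).PosSemidef := by
  refine (hΦ _ _ ?_).transpose
  rw [unnormalizedMaxEntangled_eq]
  exact Matrix.posSemidef_vecMulVec_self_star _

theorem choiMatrix_apply {dI dO : ℕ}
    (Φ : Matrix (Fin dI) (Fin dI) ℂ →ₗ[ℂ] Matrix (Fin dO) (Fin dO) ℂ) (i j : Fin dI)
    (o u : Fin dO) : choiMatrix Φ (i, o) (j, u) = Φ (Matrix.single j i 1) u o := by
  simp only [choiMatrix, Matrix.transpose_apply, ampliation, Matrix.of_apply]
  congr 3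

/-- This is trace preservation evaluated on matrix units. -/
theorem IsInstrument.traceOut_sum_choiMatrix {D dI dO : ℕ}
    {Φ : Fin D → (Matrix (Fin dI) (Fin dI) ℂ →ₗ[ℂ] Matrix (Fin dO) (Fin dO) ℂ)}
    (hΦ : IsInstrument Φ) : traceOut (∑ x, choiMatrix (Φ x)) = 1 := by
  ext i j
  have h := hΦ.2 (Matrix.single j i 1)
  simp only [Matrix.trace, Matrix.diag_apply, Matrix.sum_apply, Matrix.single_apply] at h
  simp only [traceOut, Matrix.of_apply, Matrix.sum_apply, choiMatrix_apply, h, Matrix.one_apply]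
  by_cases hij : i = j
  · subst hij
    simp
  · rw [if_neg hij]
    refine Finset.sum_eq_zero fun k _ => if_neg fun hk => hij (hk.2.trans hk.1.symm)

/-- The correlation realized by a process matrix with instruments. -/
theorem exists_quantumCorrelation {N M D : ℕ} {dI dO : Fin N → ℕ} {W : GlobalOperator dI dO}
    (hW : IsProcessMatrix W)
    {Φ : (k : Fin N) → Fin M → Fin D →
      (Matrix (Fin (dI k)) (Fin (dI k)) ℂ →ₗ[ℂ] Matrix (Fin (dO k)) (Fin (dO k)) ℂ)}
    (hΦ : ∀ k a, IsInstrument (Φ k a)) :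
    ∃ p : Correlation N M D, ∀ x a, (p.prob x a : ℂ) = quantumProb W Φ x a := by
  have h0 : ∀ x a, 0 ≤ quantumProb W Φ x a := fun x a => by
    rw [quantumProb_eq_quantumForm]
    exact quantumForm_nonneg hW.1 fun k => ((hΦ k (a k)).1 _).posSemidef_choiMatrix
  have hre : ∀ x a, ((quantumProb W Φ x a).re : ℂ) = quantumProb W Φ x a := fun x a =>
    Complex.ext rfl (Complex.le_def.1 (h0 x a)).2
  refine ⟨⟨fun x a => (quantumProb W Φ x a).re, fun x a => (Complex.le_def.1 (h0 x a)).1,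
    fun a => ?_⟩, hre⟩
  rw [← Complex.ofReal_inj, Complex.ofReal_sum]
  simp_rw [hre, quantumProb_eq_quantumForm]
  rw [← (quantumForm W).map_sum fun k x => choiMatrix (Φ k (a k) x), Complex.ofReal_one]
  exact quantumForm_eq_one hW (fun k => Matrix.posSemidef_sum _ fun x _ =>
    ((hΦ k (a k)).1 x).posSemidef_choiMatrix) fun k => (hΦ k (a k)).traceOut_sum_choiMatrix

/-- The map `ρ ↦ K ρ Kᴴ`. -/
def krausMap {dI dO : ℕ} (K : Matrix (Fin dO) (Fin dI) ℂ) :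
    Matrix (Fin dI) (Fin dI) ℂ →ₗ[ℂ] Matrix (Fin dO) (Fin dO) ℂ where
  toFun ρ := K * ρ * K.conjTranspose
  map_add' ρ σ := by rw [Matrix.mul_add, Matrix.add_mul]
  map_smul' c ρ := by simp

theorem krausMap_apply {dI dO : ℕ} (K : Matrix (Fin dO) (Fin dI) ℂ)
    (ρ : Matrix (Fin dI) (Fin dI) ℂ) : krausMap K ρ = K * ρ * K.conjTranspose := rfl

/-- The ampliation is conjugation by `1 ⊗ K`. -/
theorem isCompletelyPositive_krausMap {dI dO : ℕ} (K : Matrix (Fin dO) (Fin dI) ℂ) :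
    IsCompletelyPositive (krausMap K) := by
  intro n X hX
  have : ampliation (krausMap K) X = Matrix.kronecker (1 : Matrix (Fin n) (Fin n) ℂ) K * X *
      (Matrix.kronecker (1 : Matrix (Fin n) (Fin n) ℂ) K).conjTranspose := by
    ext s t
    simp [ampliation, krausMap_apply, Matrix.mul_apply, Fintype.sum_prod_type, Matrix.one_apply,
      Finset.sum_mul, apply_ite (starRingEnd ℂ)]
  rw [this]
  exact hX.mul_mul_conjTranspose_same _

theorem IsCompletelyPositive.sum {ι : Type*} {dI dO : ℕ} (s : Finset ι)
    {Φ : ι → (Matrix (Fin dI) (Fin dI) ℂ →ₗ[ℂ] Matrix (Fin dO) (Fin dO) ℂ)}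
    (hΦ : ∀ x ∈ s, IsCompletelyPositive (Φ x)) : IsCompletelyPositive (∑ x ∈ s, Φ x) := by
  intro n X hX
  have : ampliation (∑ x ∈ s, Φ x) X = ∑ x ∈ s, ampliation (Φ x) X := by
    ext u t
    simp [ampliation, Matrix.sum_apply]
  rw [this]
  exact Matrix.posSemidef_sum _ fun x hx => hΦ x hx n X hX

theorem IsCompletelyPositive.smul {dI dO : ℕ}
    {Φ : Matrix (Fin dI) (Fin dI) ℂ →ₗ[ℂ] Matrix (Fin dO) (Fin dO) ℂ}
    (hΦ : IsCompletelyPositive Φ) {c : ℂ} (hc : 0 ≤ c) : IsCompletelyPositive (c • Φ) :=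
  fun n X hX => (hΦ n X hX).smul hc

theorem isCompletelyPositive_zero {dI dO : ℕ} :
    IsCompletelyPositive (0 : Matrix (Fin dI) (Fin dI) ℂ →ₗ[ℂ] Matrix (Fin dO) (Fin dO) ℂ) :=
  fun _ _ _ => Matrix.PosSemidef.zero

theorem isCompletelyPositive_id {d : ℕ} :
    IsCompletelyPositive (LinearMap.id : Matrix (Fin d) (Fin d) ℂ →ₗ[ℂ] _) :=
  fun _ _ hX => hX

/-! ### Classical processes as process matrices -/

/-- The instrument that measures the input, applies a classical intervention, and prepares the
output. -/
def measurePrepare {M D dI dO : ℕ} (L : LocalIntervention M D dI dO) (a : Fin M) (x : Fin D) :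
    Matrix (Fin dI) (Fin dI) ℂ →ₗ[ℂ] Matrix (Fin dO) (Fin dO) ℂ :=
  ∑ i, ∑ o, (L.prob x o a i : ℂ) • krausMap (Matrix.single o i 1)

theorem measurePrepare_apply {M D dI dO : ℕ} (L : LocalIntervention M D dI dO) (a : Fin M)
    (x : Fin D) (ρ : Matrix (Fin dI) (Fin dI) ℂ) (o : Fin dO) :
    measurePrepare L a x ρ o o = ∑ i, (L.prob x o a i : ℂ) * ρ i i := by
  simp only [measurePrepare, LinearMap.sum_apply, LinearMap.smul_apply, krausMap_apply,
    Matrix.sum_apply, Matrix.smul_apply, smul_eq_mul]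
  refine Finset.sum_congr rfl fun i _ => ?_
  rw [Finset.sum_eq_single o]
  · simp
  · intro u _ hu
    simp [hu]
  · simp

theorem isInstrument_measurePrepare {M D dI dO : ℕ} (L : LocalIntervention M D dI dO)
    (a : Fin M) : IsInstrument (measurePrepare L a) := by
  refine ⟨fun x => IsCompletelyPositive.sum _ fun i _ => IsCompletelyPositive.sum _ fun o _ =>
    (isCompletelyPositive_krausMap _).smul (by exact_mod_cast L.nonneg _ _ _ _), fun ρ => ?_⟩
  simp only [Matrix.trace, Matrix.diag_apply, Matrix.sum_apply, measurePrepare_apply]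
  rw [Finset.sum_comm]
  refine (Finset.sum_congr rfl fun x _ => Finset.sum_comm).trans ?_
  rw [Finset.sum_comm]
  refine Finset.sum_congr rfl fun i _ => ?_
  simp_rw [← Finset.sum_mul]
  rw [show ∑ x, ∑ o, (L.prob x o a i : ℂ) = 1 by exact_mod_cast L.sum_one a i, one_mul]

theorem choiMatrix_measurePrepare_diag {M D dI dO : ℕ} (L : LocalIntervention M D dI dO)
    (a : Fin M) (x : Fin D) (s : Fin dI × Fin dO) :
    choiMatrix (measurePrepare L a x) s s = (L.prob x s.2 a s.1 : ℂ) := by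
  rw [choiMatrix_apply, measurePrepare_apply, Finset.sum_eq_single s.1]
  · simp
  · intro i _ hi
    simp [hi.symm]
  · simp

/-- The diagonal operator of an environment. -/
def diagonalProcess {N : ℕ} {dI dO : Fin N → ℕ} (P : Environment dI dO) : GlobalOperator dI dO :=
  Matrix.diagonal fun s => (P (fun k => (s k).1) (fun k => (s k).2) : ℂ)

theorem quantumForm_diagonalProcess {N : ℕ} {dI dO : Fin N → ℕ} (P : Environment dI dO)
    (A : (k : Fin N) → Matrix (Fin (dI k) × Fin (dO k)) (Fin (dI k) × Fin (dO k)) ℂ)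
    (h : (k : Fin N) → Fin (dI k) → Fin (dO k) → ℝ)
    (hA : ∀ k s, A k s s = (h k s.1 s.2 : ℂ)) :
    quantumForm (diagonalProcess P) A = (processForm P h : ℂ) := by
  rw [quantumForm_apply, processForm_apply, diagonalProcess, Matrix.trace]
  push_cast
  rw [← Fintype.sum_prod_type']
  refine Fintype.sum_equiv (Equiv.arrowProdEquivProdArrow (Fin N) _ _) _ _ fun s => ?_
  rw [Matrix.diag_apply, Matrix.diagonal_mul, mul_comm]
  simp [tensorOperator, hA, Equiv.arrowProdEquivProdArrow]

/-- A diagonal operator sees only the diagonals of the `A k`, and `Tr_O A = 1` makes these diagonals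
real stochastic arrays, to which classical consistency applies. -/
theorem isProcessMatrix_diagonalProcess {N : ℕ} {dI dO : Fin N → ℕ} {P : Environment dI dO}
    (hP : IsClassicalProcess P) : IsProcessMatrix (diagonalProcess P) := by
  refine ⟨Matrix.PosSemidef.diagonal fun s => ?_, fun A hA => ?_⟩
  · exact Complex.zero_le_real.2 (hP.1.1 _ _)
  · have hre : ∀ k s, A k s s = ((A k s s).re : ℂ) := fun k s =>
      Complex.ext rfl (Complex.le_def.1 ((hA k).1.diag_nonneg (i := s))).2.symm
    rw [← quantumForm_apply, quantumForm_diagonalProcess P A (fun k i o => (A k (i, o) (i, o)).re)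
      (fun k s => hre k s), processForm_eq_one (isClassicalProcess_iff.1 hP).2, Complex.ofReal_one]
    intro k i
    have h1 := congrFun (congrFun (hA k).2 i) i
    rw [Matrix.one_apply_eq] at h1
    rw [← Complex.ofReal_inj, Complex.ofReal_sum, Complex.ofReal_one, ← h1]
    exact Finset.sum_congr rfl fun o _ => (hre k (i, o)).symm

theorem PC_subset_QP (N M D : ℕ) : PC N M D ⊆ QP N M D := by
  rintro p ⟨dI, dO, hI, hO, P, hP, L, hL⟩
  refine ⟨dI, dO, hI, hO, diagonalProcess P, isProcessMatrix_diagonalProcess hP,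
    fun k => measurePrepare (L k), fun k a => isInstrument_measurePrepare _ _, fun x a => ?_⟩
  rw [quantumProb_eq_quantumForm, hL, classicalProb_eq_processForm]
  refine (quantumForm_diagonalProcess P _ _ fun k s => ?_).symm
  exact choiMatrix_measurePrepare_diag _ _ _ _

theorem QP_subset_qC (N M D : ℕ) : QP N M D ⊆ qC N M D := fun p _ => mem_qC p

/-! ### Perfect two-way signalling is not a quantum process correlation -/

theorem traceOut_add {dI dO : ℕ} (A B : Matrix (Fin dI × Fin dO) (Fin dI × Fin dO) ℂ) :
    traceOut (A + B) = traceOut A + traceOut B := by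
  ext i j
  simp [traceOut, Finset.sum_add_distrib]

theorem traceOut_smul {dI dO : ℕ} (c : ℝ) (A : Matrix (Fin dI × Fin dO) (Fin dI × Fin dO) ℂ) :
    traceOut (c • A) = c • traceOut A := by
  ext i j
  simp [traceOut, Finset.mul_sum]

theorem posSemidef_traceOut {dI dO : ℕ} {A : Matrix (Fin dI × Fin dO) (Fin dI × Fin dO) ℂ}
    (hA : A.PosSemidef) : (traceOut A).PosSemidef := by
  have : traceOut A = ∑ o, A.submatrix (fun i => (i, o)) fun i => (i, o) := by
    ext i j
    simp [traceOut, Matrix.sum_apply]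
  rw [this]
  exact Matrix.posSemidef_sum _ fun o _ => hA.submatrix _

/-- The map `E ↦ E ⊗ 1 / d`, a right inverse of the partial trace over the output. -/
def liftOut {dI : ℕ} (dO : ℕ) :
    Matrix (Fin dI) (Fin dI) ℂ →ₗ[ℝ] Matrix (Fin dI × Fin dO) (Fin dI × Fin dO) ℂ where
  toFun E := (dO : ℝ)⁻¹ • Matrix.kronecker E 1
  map_add' E F := by simp [Matrix.kronecker, Matrix.add_kronecker]
  map_smul' c E := by
    ext
    simp [mul_left_comm, mul_assoc]

theorem liftOut_apply {dI : ℕ} (dO : ℕ) (E : Matrix (Fin dI) (Fin dI) ℂ) :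
    liftOut dO E = (dO : ℝ)⁻¹ • Matrix.kronecker E 1 := rfl

theorem traceOut_liftOut {dI dO : ℕ} (hO : 0 < dO) (E : Matrix (Fin dI) (Fin dI) ℂ) :
    traceOut (liftOut dO E) = E := by
  have h : (dO : ℂ) ≠ 0 := Nat.cast_ne_zero.2 hO.ne'
  ext i j
  simp [liftOut_apply, traceOut, h]

theorem posSemidef_liftOut {dI : ℕ} (dO : ℕ) {E : Matrix (Fin dI) (Fin dI) ℂ}
    (hE : E.PosSemidef) : (liftOut dO E).PosSemidef :=
  (hE.kronecker Matrix.PosSemidef.one).smul (inv_nonneg.2 (Nat.cast_nonneg dO))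

/-- The Hermitian matrix `S` satisfies `S² = d S`, so it is a positive multiple of `Sᴴ S`. -/
theorem posSemidef_smul_one_sub_ones (d : ℕ) :
    ((d : ℝ) • (1 : Matrix (Fin d) (Fin d) ℂ) - Matrix.of fun _ _ => 1).PosSemidef := by
  rcases Nat.eq_zero_or_pos d with rfl | hd
  · convert Matrix.PosSemidef.zero
    exact Matrix.ext fun i _ => i.elim0
  set S : Matrix (Fin d) (Fin d) ℂ := (d : ℝ) • 1 - Matrix.of fun _ _ => 1 with hS
  have h1 : S.conjTranspose = S := by
    ext i j
    simp [hS, Matrix.one_apply, eq_comm, apply_ite (starRingEnd ℂ)]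
  have h2 : S = (d : ℝ)⁻¹ • (S.conjTranspose * S) := by
    have h : (d : ℂ) ≠ 0 := Nat.cast_ne_zero.2 hd.ne'
    rw [h1]
    ext i j
    simp [hS, Matrix.mul_apply, Matrix.one_apply, sub_mul, mul_sub]
    field_simp
  rw [h2]
  exact (Matrix.posSemidef_conjTranspose_mul_self S).smul (inv_nonneg.2 (Nat.cast_nonneg d))

/-- This is the operator bound `A ≤ d (Tr_O A ⊗ 1)`. The difference consists of `d` times the
diagonal blocks placed at the other output positions, plus the Schur product of `A` with `d 1 - J`
acting on the output index, where `J` is the all-ones matrix. It turns a vanishing reduced weight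
into a vanishing probability. -/
theorem posSemidef_smul_liftOut_sub {dI dO : ℕ}
    {A : Matrix (Fin dI × Fin dO) (Fin dI × Fin dO) ℂ} (hA : A.PosSemidef) :
    ((dO : ℝ) ^ 2 • liftOut dO (traceOut A) - A).PosSemidef := by
  have h : (dO : ℝ) ^ 2 • liftOut dO (traceOut A) - A =
      (dO : ℝ) • (∑ o, Matrix.kronecker (A.submatrix (fun i => (i, o)) fun i => (i, o))
        (Matrix.diagonal fun u => if u = o then 0 else 1)) +
      Matrix.hadamard A (((dO : ℝ) • (1 : Matrix (Fin dO) (Fin dO) ℂ) -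
        Matrix.of fun _ _ => 1).submatrix Prod.snd Prod.snd) := by
    ext ⟨i, o⟩ ⟨j, u⟩
    have hd : (dO : ℂ) ≠ 0 := Nat.cast_ne_zero.2 (Fin.pos o).ne'
    rcases eq_or_ne o u with rfl | hou
    · have h1 : ∑ v, A (i, v) (j, v) * (if o = v then 0 else 1) =
          ∑ v, A (i, v) (j, v) - A (i, o) (j, o) := by
        rw [← Finset.add_sum_erase _ _ (Finset.mem_univ o),
          ← Finset.add_sum_erase _ (fun v => A (i, v) (j, v)) (Finset.mem_univ o)]
        rw [if_pos rfl, mul_zero, zero_add, add_sub_cancel_left]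
        exact Finset.sum_congr rfl fun v hv => by
          rw [if_neg (Finset.ne_of_mem_erase hv).symm, mul_one]
      simp [liftOut_apply, traceOut, Matrix.sum_apply, Matrix.hadamard_apply] at h1 ⊢
      rw [h1]
      field_simp
      ring
    · simp [liftOut_apply, Matrix.sum_apply, Matrix.hadamard_apply, hou]
  rw [h]
  refine ((Matrix.posSemidef_sum _ fun o _ => ?_).smul (Nat.cast_nonneg dO)).add
    (hA.hadamard ((posSemidef_smul_one_sub_ones dO).submatrix _))
  refine (hA.submatrix _).kronecker (Matrix.PosSemidef.diagonal fun u => ?_)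
  dsimp only [Pi.zero_apply]
  split_ifs <;> simp

section TwoWay

variable {dI dO dI' dO' : ℕ}
  {β : Matrix (Fin dI × Fin dO) (Fin dI × Fin dO) ℂ →ₗ[ℝ]
    Matrix (Fin dI' × Fin dO') (Fin dI' × Fin dO') ℂ →ₗ[ℝ] ℝ}

/-- A bipartite process evaluated on an effect of the first party and a channel of the second one
depends only on the reduction of the effect to the input system. -/
theorem form_eq_form_liftOut (hO : 0 < dO)
    (hone : ∀ X Y, X.PosSemidef → Y.PosSemidef → traceOut X = 1 → traceOut Y = 1 → β X Y = 1)
    {X Y} (hX : X.PosSemidef) (hX1 : (1 - traceOut X).PosSemidef) (hY : Y.PosSemidef)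
    (hY1 : traceOut Y = 1) : β X Y = β (liftOut dO (traceOut X)) Y := by
  -- Both `X` and its lifted reduction become channels when the lift of `1 - traceOut X` is added,
  -- so they have equal values.
  have h1 := hone (X + liftOut dO (1 - traceOut X)) Y (hX.add (posSemidef_liftOut dO hX1)) hY
    (by rw [traceOut_add, traceOut_liftOut hO, add_sub_cancel]) hY1
  have h2 := hone (liftOut dO 1) Y (posSemidef_liftOut dO Matrix.PosSemidef.one) hY
    (traceOut_liftOut hO 1) hY1
  rw [map_add, LinearMap.add_apply, map_sub, map_sub, LinearMap.sub_apply, h2] at h1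
  linarith

/-- Summed over `y`, the value is that of `A a x` against a channel, which is zero for `x ≠ b`;
positivity then kills each term. For `x = b` the complementary effect contributes zero, so the
lifted effect may be replaced by the lifted identity. -/
theorem form_liftOut_of_perfect_signalling (hO : 0 < dO)
    (hpos : ∀ X Y, X.PosSemidef → Y.PosSemidef → 0 ≤ β X Y)
    (hone : ∀ X Y, X.PosSemidef → Y.PosSemidef → traceOut X = 1 → traceOut Y = 1 → β X Y = 1)
    {A : Fin 2 → Fin 2 → Matrix (Fin dI × Fin dO) (Fin dI × Fin dO) ℂ}
    {B : Fin 2 → Fin 2 → Matrix (Fin dI' × Fin dO') (Fin dI' × Fin dO') ℂ}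
    (hA : ∀ a x, (A a x).PosSemidef) (hB : ∀ b y, (B b y).PosSemidef)
    (hA1 : ∀ a, traceOut (A a 0 + A a 1) = 1) (hB1 : ∀ b, traceOut (B b 0 + B b 1) = 1)
    (h : ∀ a b x y, β (A a x) (B b y) = if x = b ∧ y = a then 1 else 0) (a b x y : Fin 2) :
    β (liftOut dO (traceOut (A a x))) (B b y) =
      if x = b then β (liftOut dO 1) (B b y) else 0 := by
  have hsum : ∀ a, traceOut (A a 0) + traceOut (A a 1) = 1 := fun a => by
    rw [← traceOut_add, hA1]
  have hcompl : ∀ a x, 1 - traceOut (A a x) = traceOut (A a (1 - x)) := fun a x => by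
    rw [← hsum a]
    fin_cases x <;> simp
  have hE : ∀ a x, (traceOut (A a x)).PosSemidef := fun a x => posSemidef_traceOut (hA a x)
  have hoff : ∀ x, x ≠ b → β (liftOut dO (traceOut (A a x))) (B b y) = 0 := by
    intro x hx
    have h1 := form_eq_form_liftOut hO hone (hA a x) (by rw [hcompl]; exact hE a _)
      ((hB b 0).add (hB b 1)) (hB1 b)
    rw [map_add, map_add, h, h, if_neg fun h => hx h.1, if_neg fun h => hx h.1] at h1
    have h2 := hpos _ _ (posSemidef_liftOut dO (hE a x)) (hB b 0)
    have h3 := hpos _ _ (posSemidef_liftOut dO (hE a x)) (hB b 1)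
    fin_cases y <;> simp only [Fin.zero_eta, Fin.mk_one] <;> linarith
  split_ifs with hxb
  · have h4 := hoff (1 - x) (by subst hxb; fin_cases x <;> simp)
    rw [← hcompl, map_sub, map_sub, LinearMap.sub_apply] at h4
    linarith
  · exact hoff x hxb

/-- Two parties in a bipartite process cannot guess each other's settings with certainty. -/
theorem not_perfect_two_way_signalling (hO : 0 < dO) (hO' : 0 < dO')
    (hpos : ∀ X Y, X.PosSemidef → Y.PosSemidef → 0 ≤ β X Y)
    (hone : ∀ X Y, X.PosSemidef → Y.PosSemidef → traceOut X = 1 → traceOut Y = 1 → β X Y = 1)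
    {A : Fin 2 → Fin 2 → Matrix (Fin dI × Fin dO) (Fin dI × Fin dO) ℂ}
    {B : Fin 2 → Fin 2 → Matrix (Fin dI' × Fin dO') (Fin dI' × Fin dO') ℂ}
    (hA : ∀ a x, (A a x).PosSemidef) (hB : ∀ b y, (B b y).PosSemidef)
    (hA1 : ∀ a, traceOut (A a 0 + A a 1) = 1) (hB1 : ∀ b, traceOut (B b 0 + B b 1) = 1)
    (h : ∀ a b x y, β (A a x) (B b y) = if x = b ∧ y = a then 1 else 0) : False := by
  have hsA : ∀ a, traceOut (A a 0) + traceOut (A a 1) = 1 := fun a => by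
    rw [← traceOut_add, hA1]
  have hsB : ∀ a, traceOut (B a 0) + traceOut (B a 1) = 1 := fun a => by
    rw [← traceOut_add, hB1]
  have hE : ∀ a x, (liftOut dO (traceOut (A a x))).PosSemidef := fun a x =>
    posSemidef_liftOut dO (posSemidef_traceOut (hA a x))
  have hG : ∀ b y, (liftOut dO' (traceOut (B b y))).PosSemidef := fun b y =>
    posSemidef_liftOut dO' (posSemidef_traceOut (hB b y))
  have hm := form_liftOut_of_perfect_signalling hO hpos hone hA hB hA1 hB1 h
  have hn := form_liftOut_of_perfect_signalling (β := β.flip) hO' (fun X Y hX hY => hpos Y X hY hX)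
    (fun X Y hX hY hX1 hY1 => hone Y X hY hX hY1 hX1) hB hA hB1 hA1
    (fun a b x y => by rw [LinearMap.flip_apply, h]; simp [and_comm])
  have hmG : ∀ b y, β (liftOut dO 1) (B b y) = β (liftOut dO 1) (liftOut dO' (traceOut (B b y))) :=
    fun b y => form_eq_form_liftOut (β := β.flip) hO'
      (fun X Y hX hY hX1 hY1 => hone Y X hY hX hY1 hX1) (hB b y)
      (by
        rw [← hsB b]
        fin_cases y <;> simp [posSemidef_traceOut (hB b _)])
      (posSemidef_liftOut dO Matrix.PosSemidef.one) (traceOut_liftOut hO 1)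
  have hnE : ∀ a x, β (A a x) (liftOut dO' 1) = β (liftOut dO (traceOut (A a x))) (liftOut dO' 1) :=
    fun a x => form_eq_form_liftOut hO hone (hA a x)
      (by
        rw [← hsA a]
        fin_cases x <;> simp [posSemidef_traceOut (hA a _)])
      (posSemidef_liftOut dO' Matrix.PosSemidef.one) (traceOut_liftOut hO' 1)
  -- Test channels made of outcome operators whose joint events all lose the game, completed to
  -- channels by the lifted reductions of the remaining outcomes.
  have hC := hone ((1 / 2 : ℝ) • (A 0 0 + A 1 1 + liftOut dO (traceOut (A 0 1)) +
      liftOut dO (traceOut (A 1 0))))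
    ((1 / 2 : ℝ) • (B 1 0 + B 0 1 + liftOut dO' (traceOut (B 1 1)) +
      liftOut dO' (traceOut (B 0 0))))
    (((((hA 0 0).add (hA 1 1)).add (hE 0 1)).add (hE 1 0)).smul (by norm_num))
    (((((hB 1 0).add (hB 0 1)).add (hG 1 1)).add (hG 0 0)).smul (by norm_num))
    (by
      rw [traceOut_smul, traceOut_add, traceOut_add, traceOut_add, traceOut_liftOut hO,
        traceOut_liftOut hO, show traceOut (A 0 0) + traceOut (A 1 1) + traceOut (A 0 1) +
          traceOut (A 1 0) = (traceOut (A 0 0) + traceOut (A 0 1)) +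
            (traceOut (A 1 0) + traceOut (A 1 1)) by abel, hsA, hsA, ← two_smul ℝ, smul_smul]
      norm_num)
    (by
      rw [traceOut_smul, traceOut_add, traceOut_add, traceOut_add, traceOut_liftOut hO',
        traceOut_liftOut hO', show traceOut (B 1 0) + traceOut (B 0 1) + traceOut (B 1 1) +
          traceOut (B 0 0) = (traceOut (B 0 0) + traceOut (B 0 1)) +
            (traceOut (B 1 0) + traceOut (B 1 1)) by abel, hsB, hsB, ← two_smul ℝ, smul_smul]
      norm_num)
  have hn' : ∀ a b x y, β (A a x) (liftOut dO' (traceOut (B b y))) =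
      if y = a then β (liftOut dO (traceOut (A a x))) (liftOut dO' 1) else 0 := fun a b x y => by
    rw [← hnE]
    exact hn b a y x
  simp only [map_add, map_smul, LinearMap.add_apply, LinearMap.smul_apply, h, hn', hm, hmG,
    smul_eq_mul] at hC
  norm_num at hC
  have hJ0 : ∀ a x b y, 0 ≤ β (liftOut dO (traceOut (A a x))) (liftOut dO' (traceOut (B b y))) :=
    fun a x b y => hpos _ _ (hE a x) (hG b y)
  have hJA : ∀ a Y, β (liftOut dO (traceOut (A a 0))) Y + β (liftOut dO (traceOut (A a 1))) Y =
      β (liftOut dO 1) Y := fun a Y => by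
    rw [← LinearMap.add_apply, ← map_add, ← map_add, hsA]
  have hJB : ∀ b X, β X (liftOut dO' (traceOut (B b 0))) + β X (liftOut dO' (traceOut (B b 1))) =
      β X (liftOut dO' 1) := fun b X => by
    rw [← map_add, ← map_add, hsB]
  have h11 : β (liftOut dO 1) (liftOut dO' 1) = 1 :=
    hone _ _ (posSemidef_liftOut dO Matrix.PosSemidef.one)
      (posSemidef_liftOut dO' Matrix.PosSemidef.one) (traceOut_liftOut hO 1) (traceOut_liftOut hO' 1)
  -- On lifted effects `β` is a no-signalling distribution. With `e₀, e₁, f₀, f₁` the marginal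
  -- weights of `A 0 0`, `A 1 1`, `B 0 1`, `B 1 0`, the normalization `hC` says that these and four
  -- joint weights sum to 4. Each joint weight is at most the mean of its two marginals, a `1 - e`
  -- and a `1 - f`, so 4 is the largest possible value. Equality makes the joint weight of `A 0 1`,
  -- `B 0 0` equal to the whole marginal of `B 0 0`, leaving nothing for `A 0 0`, `B 0 0`.
  have hzero : β (liftOut dO (traceOut (A 0 0))) (liftOut dO' (traceOut (B 0 0))) ≤ 0 := by
    linarith [hJ0 0 0 1 0, hJ0 0 0 0 1, hJ0 1 1 1 0, hJ0 1 1 0 1, hJ0 0 1 0 0, hJ0 0 1 1 1,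
      hJ0 1 0 0 0, hJ0 1 0 1 1, hJ0 0 0 0 0, hJ0 0 0 1 1, hJ0 1 1 0 0, hJ0 1 1 1 1,
      hJ0 0 1 0 1, hJ0 0 1 1 0, hJ0 1 0 0 1, hJ0 1 0 1 0,
      hJA 0 (liftOut dO' (traceOut (B 0 0))), hJA 0 (liftOut dO' (traceOut (B 0 1))),
      hJA 0 (liftOut dO' (traceOut (B 1 0))), hJA 0 (liftOut dO' (traceOut (B 1 1))),
      hJA 1 (liftOut dO' (traceOut (B 0 0))), hJA 1 (liftOut dO' (traceOut (B 0 1))),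
      hJA 1 (liftOut dO' (traceOut (B 1 0))), hJA 1 (liftOut dO' (traceOut (B 1 1))),
      hJB 0 (liftOut dO (traceOut (A 0 0))), hJB 0 (liftOut dO (traceOut (A 0 1))),
      hJB 0 (liftOut dO (traceOut (A 1 0))), hJB 0 (liftOut dO (traceOut (A 1 1))),
      hJB 1 (liftOut dO (traceOut (A 0 0))), hJB 1 (liftOut dO (traceOut (A 0 1))),
      hJB 1 (liftOut dO (traceOut (A 1 0))), hJB 1 (liftOut dO (traceOut (A 1 1))),
      hJB 0 (liftOut dO 1), hJB 1 (liftOut dO 1), hJA 0 (liftOut dO' 1), hJA 1 (liftOut dO' 1)]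
  -- Domination by the lifted reduction, first in `A 0 0` and then in `B 0 0`, bounds the certain
  -- event `β (A 0 0) (B 0 0) = 1` by a multiple of the vanishing weight.
  have hle1 := hpos _ _ (posSemidef_smul_liftOut_sub (hA 0 0)) (hB 0 0)
  have hle2 := hpos _ _ (hE 0 0) (posSemidef_smul_liftOut_sub (hB 0 0))
  rw [map_sub, LinearMap.sub_apply, map_smul, LinearMap.smul_apply, h, smul_eq_mul] at hle1
  rw [map_sub, map_smul, smul_eq_mul] at hle2
  have h3 : (dO' : ℝ) ^ 2 * β (liftOut dO (traceOut (A 0 0))) (liftOut dO' (traceOut (B 0 0))) ≤ 0 :=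
    mul_nonpos_of_nonneg_of_nonpos (by positivity) hzero
  have h4 : (dO : ℝ) ^ 2 * β (liftOut dO (traceOut (A 0 0))) (B 0 0) ≤ 0 :=
    mul_nonpos_of_nonneg_of_nonpos (by positivity) (by linarith)
  norm_num at hle1
  linarith

end TwoWay

/-! ### Two distinguished parties among `n + 2` -/

/-- The family with value `s` at party `0`, `t` at party `1`, and `u` at all other parties. -/
def pairFamily {α : Type*} (n : ℕ) (s t u : α) : Fin (n + 2) → α :=
  fun k => if k = 0 then s else if k = 1 then t else u

@[simp] theorem pairFamily_zero {α : Type*} (n : ℕ) (s t u : α) : pairFamily n s t u 0 = s := rfl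

@[simp] theorem pairFamily_one {α : Type*} (n : ℕ) (s t u : α) : pairFamily n s t u 1 = t := by
  simp [pairFamily]

theorem pairFamily_of_ne {α : Type*} {n : ℕ} (s t u : α) {k : Fin (n + 2)} (h0 : k ≠ 0)
    (h1 : k ≠ 1) : pairFamily n s t u k = u := by
  simp [pairFamily, h0, h1]

theorem update_update_eq_of_eq {n : ℕ} {E : Fin (n + 2) → Type*} {F C : (k : Fin (n + 2)) → E k}
    (h : ∀ k, k ≠ 0 → k ≠ 1 → F k = C k) :
    Function.update (Function.update C 0 (F 0)) 1 (F 1) = F := by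
  funext k
  by_cases h1 : k = 1
  · subst h1
    simp
  · rw [Function.update_of_ne h1]
    by_cases h0 : k = 0
    · subst h0
      simp
    · rw [Function.update_of_ne h0, h k h0 h1]

/-- The bilinear form of parties `0` and `1` that a multilinear form becomes when the arguments of
the other parties are fixed. -/
def MultilinearMap.pairForm {R : Type*} [CommRing R] {n : ℕ} {E : Fin (n + 2) → Type*}
    [∀ k, AddCommGroup (E k)] [∀ k, Module R (E k)] (μ : MultilinearMap R E R)
    (C : (k : Fin (n + 2)) → E k) : E 0 →ₗ[R] E 1 →ₗ[R] R :=
  LinearMap.mk₂ R (fun X Y => μ (Function.update (Function.update C 0 X) 1 Y))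
    (fun X X' Y => by
      simp only [Function.update_comm (zero_ne_one' (Fin (n + 2))), μ.map_update_add])
    (fun c X Y => by
      simp only [Function.update_comm (zero_ne_one' (Fin (n + 2))), μ.map_update_smul])
    (fun X Y Y' => μ.map_update_add _ _ _ _)
    (fun c X Y => μ.map_update_smul _ _ _ _)

theorem MultilinearMap.pairForm_apply {R : Type*} [CommRing R] {n : ℕ} {E : Fin (n + 2) → Type*}
    [∀ k, AddCommGroup (E k)] [∀ k, Module R (E k)] (μ : MultilinearMap R E R)
    (C : (k : Fin (n + 2)) → E k) (X : E 0) (Y : E 1) :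
    μ.pairForm C X Y = μ (Function.update (Function.update C 0 X) 1 Y) := rfl

theorem forall_update_update {n : ℕ} {E : Fin (n + 2) → Type*} {C : (k : Fin (n + 2)) → E k}
    {q : (k : Fin (n + 2)) → E k → Prop} (hC : ∀ k, q k (C k)) {X : E 0} {Y : E 1} (hX : q 0 X)
    (hY : q 1 Y) (k : Fin (n + 2)) :
    q k (Function.update (Function.update C 0 X) 1 Y k) := by
  by_cases h1 : k = 1
  · subst h1
    simpa using hY
  · rw [Function.update_of_ne h1]
    by_cases h0 : k = 0
    · subst h0
      simpa using hX
    · rw [Function.update_of_ne h0]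
      exact hC k

/-- The real part of a complex bilinear form. -/
def reBilin {E F : Type*} [AddCommGroup E] [Module ℂ E] [AddCommGroup F] [Module ℂ F]
    (β : E →ₗ[ℂ] F →ₗ[ℂ] ℂ) : E →ₗ[ℝ] F →ₗ[ℝ] ℝ :=
  LinearMap.mk₂ ℝ (fun X Y => (β X Y).re) (fun X X' Y => by simp)
    (fun c X Y => by
      rw [← Complex.coe_smul, map_smul]
      simp) (fun X Y Y' => by simp)
    (fun c X Y => by
      rw [← Complex.coe_smul, map_smul]
      simp)

theorem reBilin_apply {E F : Type*} [AddCommGroup E] [Module ℂ E] [AddCommGroup F] [Module ℂ F]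
    (β : E →ₗ[ℂ] F →ₗ[ℂ] ℂ) (X : E) (Y : F) : reBilin β X Y = (β X Y).re := rfl

/-! ### A correlation outside of `QP` -/

/-- The correlation of deterministic outcomes. -/
def Correlation.deterministic {N M D : ℕ} (f : (Fin N → Fin M) → Fin N → Fin D) :
    Correlation N M D where
  prob x a := if x = f a then 1 else 0
  nonneg x a := by positivity
  sum_one a := by simp

/-- The outcome `0` or `1` that tells whether the setting is `0`. -/
def announce {M D : ℕ} (hD : 2 ≤ D) (a : Fin M) : Fin D :=
  Fin.castLE hD (if a.val = 0 then 0 else 1)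

/-- Parties `0` and `1` output each other's settings. -/
def twoWayCorrelation (n M : ℕ) {D : ℕ} (hD : 2 ≤ D) : Correlation (n + 2) M D :=
  Correlation.deterministic fun a =>
    pairFamily n (announce hD (a 1)) (announce hD (a 0)) (Fin.castLE hD 0)

/-- The outcomes that are read as the bit `y`. -/
def readSet (D : ℕ) (y : Fin 2) : Finset (Fin D) :=
  Finset.univ.filter fun x => (if x.val = 0 then (0 : Fin 2) else 1) = y

theorem announce_mem_readSet {M D : ℕ} (hM : 2 ≤ M) (hD : 2 ≤ D) (s y : Fin 2) :
    announce hD (Fin.castLE hM s) ∈ readSet D y ↔ y = s := by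
  fin_cases s <;> fin_cases y <;> simp [announce, readSet]

theorem sum_readSet {D : ℕ} {E : Type*} [AddCommMonoid E] (F : Fin D → E) :
    ∑ x ∈ readSet D 0, F x + ∑ x ∈ readSet D 1, F x = ∑ x, F x := by
  rw [← Fin.sum_univ_two fun y => ∑ x ∈ readSet D y, F x]
  exact Finset.sum_fiberwise _ _ _

/-- Bystanders keep setting `0` and sum over their outcomes, hence act by channels. Parties `0` and
`1` use two settings and coarse-grain their outcomes to a bit, which yields perfect signalling in
the reduced bipartite process. -/
theorem twoWayCorrelation_notMem_QP {n M D : ℕ} (hM : 2 ≤ M) (hD : 2 ≤ D) :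
    twoWayCorrelation n M hD ∉ QP (n + 2) M D := by
  rintro ⟨dI, dO, hI, hO, W, hW, Φ, hΦ, h⟩
  have hpsd : ∀ k a (S : Finset (Fin D)), (∑ x ∈ S, choiMatrix (Φ k a x)).PosSemidef :=
    fun k a S => Matrix.posSemidef_sum _ fun x _ => ((hΦ k a).1 x).posSemidef_choiMatrix
  let z : Fin M := Fin.castLE hM 0
  let C : (k : Fin (n + 2)) → Matrix (Fin (dI k) × Fin (dO k)) (Fin (dI k) × Fin (dO k)) ℂ :=
    fun k => ∑ x, choiMatrix (Φ k z x)
  have hC : ∀ k, (C k).PosSemidef := fun k => hpsd k z _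
  have hC1 : ∀ k, traceOut (C k) = 1 := fun k => (hΦ k z).traceOut_sum_choiMatrix
  refine not_perfect_two_way_signalling (β := reBilin ((quantumForm W).pairForm C)) (hO 0) (hO 1)
    (fun X Y hX hY => ?_) (fun X Y hX hY hX1 hY1 => ?_)
    (A := fun s y => ∑ x ∈ readSet D y, choiMatrix (Φ 0 (Fin.castLE hM s) x))
    (B := fun s y => ∑ x ∈ readSet D y, choiMatrix (Φ 1 (Fin.castLE hM s) x))
    (fun a x => hpsd _ _ _) (fun a x => hpsd _ _ _) (fun a => ?_) (fun a => ?_)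
    (fun s t x y => ?_)
  · exact (Complex.le_def.1 (quantumForm_nonneg hW.1
      (forall_update_update (q := fun _ A => Matrix.PosSemidef A) hC hX hY))).1
  · rw [reBilin_apply, MultilinearMap.pairForm_apply, quantumForm_eq_one hW
      (forall_update_update (q := fun _ A => Matrix.PosSemidef A) hC hX hY)
      (forall_update_update (q := fun _ A => traceOut A = 1) hC1 hX1 hY1), Complex.one_re]
  · rw [sum_readSet]
    exact (hΦ _ _).traceOut_sum_choiMatrix
  · rw [sum_readSet]
    exact (hΦ _ _).traceOut_sum_choiMatrix
  · let a : Fin (n + 2) → Fin M := pairFamily n (Fin.castLE hM s) (Fin.castLE hM t) z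
    let S : Fin (n + 2) → Finset (Fin D) := pairFamily n (readSet D x) (readSet D y) Finset.univ
    have hF := update_update_eq_of_eq (C := C)
      (F := fun k => ∑ x ∈ S k, choiMatrix (Φ k (a k) x))
      (fun k h0 h1 => by simp only [S, a, pairFamily_of_ne _ _ _ h0 h1, C])
    have ha1 : a 1 = Fin.castLE hM t := pairFamily_one _ _ _ _
    have hS1 : S 1 = readSet D y := pairFamily_one _ _ _ _
    rw [ha1, hS1] at hF
    rw [reBilin_apply, MultilinearMap.pairForm_apply]
    refine (congrArg (fun F => (quantumForm W F).re) hF).trans ?_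
    -- Coarse-graining gives the probability of a product set of outcome vectors; the correlation
    -- being deterministic, this is the indicator that its outcome lies in that set.
    rw [(quantumForm W).map_sum_finset (fun k x => choiMatrix (Φ k (a k) x)) S]
    simp_rw [← quantumProb_eq_quantumForm, ← h, twoWayCorrelation, Correlation.deterministic,
      ← Complex.ofReal_sum, Complex.ofReal_re]
    rw [Finset.sum_ite_eq']
    refine if_congr (Fintype.mem_piFinset.trans ⟨fun hk => ⟨?_, ?_⟩, fun hk k => ?_⟩) rfl rfl
    · have := hk 0
      rw [pairFamily_zero, ha1] at this
      exact (announce_mem_readSet hM hD t x).1 this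
    · have := hk 1
      rw [pairFamily_one, hS1] at this
      exact (announce_mem_readSet hM hD s y).1 this
    · by_cases h0 : k = 0
      · subst h0
        rw [pairFamily_zero, ha1]
        exact (announce_mem_readSet hM hD t x).2 hk.1
      · by_cases h1 : k = 1
        · subst h1
          rw [pairFamily_one, hS1]
          exact (announce_mem_readSet hM hD s y).2 hk.2
        · simp [S, pairFamily_of_ne _ _ _ h0 h1]

theorem QP_ssubset_qC {n M D : ℕ} (hM : 2 ≤ M) (hD : 2 ≤ D) : QP (n + 2) M D ⊂ qC (n + 2) M D :=
  (Set.ssubset_iff_of_subset (QP_subset_qC _ _ _)).2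
    ⟨twoWayCorrelation n M hD, mem_qC _, twoWayCorrelation_notMem_QP hM hD⟩

/-! ### Process matrices from anticommuting involutions -/

section Tensor

variable {N : ℕ} {dI dO : Fin N → ℕ}
  (A B : (k : Fin N) → Matrix (Fin (dI k) × Fin (dO k)) (Fin (dI k) × Fin (dO k)) ℂ)

theorem tensorOperator_mul :
    tensorOperator A * tensorOperator B = tensorOperator fun k => A k * B k := by
  ext s t
  simp only [tensorOperator, Matrix.mul_apply, Matrix.of_apply, ← Finset.prod_mul_distrib]
  rw [Finset.prod_univ_sum, Fintype.piFinset_univ]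

theorem tensorOperator_one :
    tensorOperator (fun k => (1 : Matrix (Fin (dI k) × Fin (dO k)) (Fin (dI k) × Fin (dO k)) ℂ)) =
      1 := by
  ext s t
  simp only [tensorOperator, Matrix.of_apply, Matrix.one_apply]
  by_cases h : s = t
  · subst h
    simp
  · obtain ⟨k, hk⟩ := Function.ne_iff.1 h
    rw [if_neg h]
    exact Finset.prod_eq_zero (Finset.mem_univ k) (if_neg hk)

theorem tensorOperator_conjTranspose :
    (tensorOperator A).conjTranspose = tensorOperator fun k => (A k).conjTranspose := by
  ext s t
  simp [tensorOperator, Matrix.conjTranspose_apply]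

theorem tensorOperator_smul (c : Fin N → ℂ) :
    tensorOperator (fun k => c k • A k) = (∏ k, c k) • tensorOperator A := by
  ext s t
  simp [tensorOperator, Finset.prod_mul_distrib]

theorem trace_tensorOperator : (tensorOperator A).trace = ∏ k, (A k).trace := by
  simp only [tensorOperator, Matrix.trace, Matrix.diag_apply, Matrix.of_apply]
  rw [Finset.prod_univ_sum, Fintype.piFinset_univ]

end Tensor

/-- Anticommutation cancels the cross terms, so `S = (A + B) / √2` satisfies `S² = 1` and `1 + S =
(1 + S)ᴴ (1 + S) / 2`. -/
theorem posSemidef_one_add_of_anticommute {n : Type*} [Fintype n] [DecidableEq n]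
    {A B : Matrix n n ℂ} (hA : A.conjTranspose = A) (hB : B.conjTranspose = B) (hAA : A * A = 1)
    (hBB : B * B = 1) (hAB : A * B = -(B * A)) :
    (1 + (1 / (Real.sqrt 2 : ℂ)) • (A + B)).PosSemidef := by
  set r : ℂ := 1 / (Real.sqrt 2 : ℂ) with hr
  have hr2 : r * r = 1 / 2 := by
    rw [hr, div_mul_div_comm, one_mul, ← Complex.ofReal_mul, Real.mul_self_sqrt zero_le_two]
    norm_num
  have hrs : star r = r := by
    rw [hr, ← Complex.ofReal_one, ← Complex.ofReal_div]
    exact Complex.conj_ofReal _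
  set S : Matrix n n ℂ := r • (A + B) with hS
  have h1 : (1 + S).conjTranspose = 1 + S := by
    simp [hS, Matrix.conjTranspose_add, Matrix.conjTranspose_smul, hA, hB, hrs]
  have h2 : S * S = 1 := by
    rw [hS, smul_mul_smul_comm, hr2, add_mul, mul_add, mul_add, hAA, hBB, hAB,
      show (1 : Matrix n n ℂ) + -(B * A) + (B * A + 1) = (2 : ℂ) • 1 by rw [two_smul]; abel,
      smul_smul]
    norm_num
  have h3 : 1 + S = (1 / 2 : ℝ) • ((1 + S).conjTranspose * (1 + S)) := by
    rw [h1, add_mul, mul_add, mul_add, h2, one_mul, one_mul, mul_one,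
      show (1 : Matrix n n ℂ) + S + (S + 1) = (2 : ℝ) • (1 + S) by rw [two_smul]; abel, smul_smul]
    norm_num
  rw [h3]
  exact (Matrix.posSemidef_conjTranspose_mul_self _).smul (by norm_num)

/-! ### The qubit process with bystanders -/

abbrev QubitOperator : Type := Matrix (Fin 2 × Fin 2) (Fin 2 × Fin 2) ℂ

def leftOps (n : ℕ) : Fin (n + 2) → QubitOperator :=
  pairFamily n (Matrix.kronecker pauliZ pauliZ) (Matrix.kronecker pauliZ 1) 1

def rightOps (n : ℕ) : Fin (n + 2) → QubitOperator :=
  pairFamily n (Matrix.kronecker pauliZ 1) (Matrix.kronecker pauliX pauliX) 1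

/-- The process `qubitW` of parties `0` and `1`, with a maximally mixed state for the input of any
other party. -/
def bystanderW (n : ℕ) : GlobalOperator (N := n + 2) (fun _ => 2) (fun _ => 2) :=
  (1 / 2 ^ (n + 2) : ℂ) • (1 + (1 / (Real.sqrt 2 : ℂ)) •
    (tensorOperator (N := n + 2) (dI := fun _ => 2) (dO := fun _ => 2) (leftOps n) +
      tensorOperator (N := n + 2) (dI := fun _ => 2) (dO := fun _ => 2) (rightOps n)))

theorem bystanderW_zero : bystanderW 0 = qubitW := by
  have h1 : leftOps 0 = ![Matrix.kronecker pauliZ pauliZ, Matrix.kronecker pauliZ 1] := by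
    funext k
    fin_cases k <;> rfl
  have h2 : rightOps 0 = ![Matrix.kronecker pauliZ 1, Matrix.kronecker pauliX pauliX] := by
    funext k
    fin_cases k <;> rfl
  rw [bystanderW, qubitW, h1, h2]
  norm_num

theorem pauliZ_mul_self : pauliZ * pauliZ = 1 := by
  ext i j
  fin_cases i <;> fin_cases j <;> simp [pauliZ]

theorem pauliX_mul_self : pauliX * pauliX = 1 := by
  ext i j
  fin_cases i <;> fin_cases j <;> simp [pauliX]

theorem pauliZ_mul_pauliX : pauliZ * pauliX = -(pauliX * pauliZ) := by
  ext i j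
  fin_cases i <;> fin_cases j <;> simp [pauliX, pauliZ]

theorem pauliZ_conjTranspose : pauliZ.conjTranspose = pauliZ := by
  ext i j
  fin_cases i <;> fin_cases j <;> simp [pauliZ]

theorem pauliX_conjTranspose : pauliX.conjTranspose = pauliX := by
  ext i j
  fin_cases i <;> fin_cases j <;> simp [pauliX]

theorem trace_pauliZ : pauliZ.trace = 0 := by simp [pauliZ, Matrix.trace]

/-- Against a channel, a factor acting trivially on the output gives `tr E`; for `E = Z` this is
zero, and for `E = 1` it is the input dimension. -/
theorem trace_kronecker_one_mul {dI dO : ℕ} (E : Matrix (Fin dI) (Fin dI) ℂ)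
    (X : Matrix (Fin dI × Fin dO) (Fin dI × Fin dO) ℂ) :
    (Matrix.kronecker E 1 * X).trace = (E * traceOut X).trace := by
  simp [Matrix.trace, Matrix.mul_apply, Fintype.sum_prod_type, Matrix.one_apply, traceOut,
    Finset.mul_sum]
  refine Finset.sum_congr rfl fun i _ => Finset.sum_comm

theorem leftOps_conjTranspose (n : ℕ) (k : Fin (n + 2)) :
    (leftOps n k).conjTranspose = leftOps n k := by
  unfold leftOps pairFamily
  split_ifs <;> simp [Matrix.kronecker, Matrix.conjTranspose_kronecker, pauliZ_conjTranspose]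

theorem rightOps_conjTranspose (n : ℕ) (k : Fin (n + 2)) :
    (rightOps n k).conjTranspose = rightOps n k := by
  unfold rightOps pairFamily
  split_ifs <;> simp [Matrix.kronecker, Matrix.conjTranspose_kronecker, pauliZ_conjTranspose,
    pauliX_conjTranspose]

theorem leftOps_mul_self (n : ℕ) (k : Fin (n + 2)) : leftOps n k * leftOps n k = 1 := by
  unfold leftOps pairFamily
  split_ifs <;> simp [Matrix.kronecker, ← Matrix.mul_kronecker_mul, pauliZ_mul_self]

theorem rightOps_mul_self (n : ℕ) (k : Fin (n + 2)) : rightOps n k * rightOps n k = 1 := by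
  unfold rightOps pairFamily
  split_ifs <;> simp [Matrix.kronecker, ← Matrix.mul_kronecker_mul, pauliZ_mul_self,
    pauliX_mul_self]

/-- The factors commute everywhere except at party `1`, where `Z` meets `X` on the input while the
left output factor is trivial. One sign makes the whole strings anticommute. -/
theorem leftOps_mul_rightOps (n : ℕ) (k : Fin (n + 2)) :
    leftOps n k * rightOps n k = pairFamily n (1 : ℂ) (-1) 1 k • (rightOps n k * leftOps n k) := by
  by_cases h0 : k = 0
  · subst h0
    simp [leftOps, rightOps, Matrix.kronecker, ← Matrix.mul_kronecker_mul]
  · by_cases h1 : k = 1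
    · subst h1
      simp [leftOps, rightOps, Matrix.kronecker, ← Matrix.mul_kronecker_mul, pauliZ_mul_pauliX]
      ext
      simp
    · simp [leftOps, rightOps, pairFamily_of_ne _ _ _ h0 h1]

theorem prod_pairFamily {R : Type*} [CommMonoid R] (n : ℕ) (s t u : R) :
    ∏ k, pairFamily n s t u k = s * (t * u ^ n) := by
  rw [Fin.prod_univ_succ, Fin.prod_univ_succ]
  congr 2
  rw [Finset.prod_congr rfl fun (k : Fin n) _ => pairFamily_of_ne s t u (k := k.succ.succ)
    (Fin.succ_ne_zero _) (by
      rw [← Fin.succ_zero_eq_one, Ne, Fin.succ_inj]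
      exact Fin.succ_ne_zero _)]
  simp

/-- Against channels the left string vanishes through `Z ⊗ 1` at party `1`, and the right one
through `Z ⊗ 1` at party `0`. Each channel operator has trace two, which the prefactor `1 / 2 ^ (n +
2)` cancels. -/
theorem isProcessMatrix_bystanderW (n : ℕ) : IsProcessMatrix (bystanderW n) := by
  constructor
  · refine Matrix.PosSemidef.smul (posSemidef_one_add_of_anticommute ?_ ?_ ?_ ?_ ?_) ?_
    · rw [tensorOperator_conjTranspose]
      simp_rw [leftOps_conjTranspose]
    · rw [tensorOperator_conjTranspose]
      simp_rw [rightOps_conjTranspose]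
    · rw [tensorOperator_mul]
      simp_rw [leftOps_mul_self]
      exact tensorOperator_one
    · rw [tensorOperator_mul]
      simp_rw [rightOps_mul_self]
      exact tensorOperator_one
    · rw [tensorOperator_mul, tensorOperator_mul]
      simp_rw [leftOps_mul_rightOps]
      rw [tensorOperator_smul, prod_pairFamily]
      simp
    · positivity
  · intro X hX
    have hZ : ∀ k, (Matrix.kronecker pauliZ (1 : Matrix (Fin 2) (Fin 2) ℂ) * X k).trace = 0 :=
      fun k => by rw [trace_kronecker_one_mul, (hX k).2, mul_one, trace_pauliZ]
    have htr : ∀ k, (X k).trace = 2 := fun k => by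
      have := trace_kronecker_one_mul (1 : Matrix (Fin 2) (Fin 2) ℂ) (X k)
      rw [(hX k).2] at this
      simpa [Matrix.kronecker] using this
    have hL : ∏ k, (leftOps n k * X k).trace = 0 :=
      Finset.prod_eq_zero (Finset.mem_univ (1 : Fin (n + 2))) (by
        rw [leftOps, pairFamily_one]
        exact hZ 1)
    have hR : ∏ k, (rightOps n k * X k).trace = 0 :=
      Finset.prod_eq_zero (Finset.mem_univ (0 : Fin (n + 2))) (hZ 0)
    rw [bystanderW, smul_mul_assoc, add_mul, one_mul, smul_mul_assoc, add_mul, tensorOperator_mul,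
      tensorOperator_mul, Matrix.trace_smul, Matrix.trace_add, Matrix.trace_smul, Matrix.trace_add,
      trace_tensorOperator, trace_tensorOperator, trace_tensorOperator, hL, hR]
    simp [htr]

theorem isProcessMatrix_qubitW : IsProcessMatrix qubitW :=
  bystanderW_zero ▸ isProcessMatrix_bystanderW 0

/-! ### The qubit instruments -/

theorem qubitMap_one (x : Fin 2) : qubitMap 1 x = krausMap (Matrix.single 0 x 1) := by
  ext ρ : 1
  simp [qubitMap, krausMap_apply, Matrix.single_mul_mul_single, LinearMap.smulRight_apply]

theorem isInstrument_qubitMap (a : Fin 2) : IsInstrument (qubitMap a) := by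
  by_cases ha : a = 0
  · subst ha
    refine ⟨fun x => ?_, fun ρ => ?_⟩
    · fin_cases x
      · exact isCompletelyPositive_zero
      · exact isCompletelyPositive_id
    · simp [qubitMap]
  · obtain rfl : a = 1 := by omega
    refine ⟨fun x => ?_, fun ρ => ?_⟩
    · rw [qubitMap_one]
      exact isCompletelyPositive_krausMap _
    · simp [qubitMap, Matrix.trace]

theorem trace_choiMatrix_qubitMap (a x : Fin 2) :
    (choiMatrix (qubitMap a x)).trace = !![0, 2; 1, 1] a x := by
  fin_cases a <;> fin_cases x <;>
    simp [Matrix.trace, Fintype.sum_prod_type, choiMatrix_apply, qubitMap, Matrix.single_apply]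

theorem trace_zz_mul_choiMatrix_qubitMap (a x : Fin 2) :
    (Matrix.kronecker pauliZ pauliZ * choiMatrix (qubitMap a x)).trace =
      !![0, 2; 1, -1] a x := by
  fin_cases a <;> fin_cases x <;>
    simp [Matrix.trace, Matrix.mul_apply, Fintype.sum_prod_type, Fin.sum_univ_two,
      choiMatrix_apply, qubitMap, Matrix.single_apply, pauliZ]
  norm_num

theorem trace_z_mul_choiMatrix_qubitMap (a x : Fin 2) :
    (Matrix.kronecker pauliZ 1 * choiMatrix (qubitMap a x)).trace =
      !![0, 0; 1, -1] a x := by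
  fin_cases a <;> fin_cases x <;>
    simp [Matrix.trace, Matrix.mul_apply, Fintype.sum_prod_type, Fin.sum_univ_two,
      choiMatrix_apply, qubitMap, Matrix.single_apply, pauliZ]

theorem trace_xx_mul_choiMatrix_qubitMap (a x : Fin 2) :
    (Matrix.kronecker pauliX pauliX * choiMatrix (qubitMap a x)).trace =
      !![0, 2; 0, 0] a x := by
  fin_cases a <;> fin_cases x <;>
    simp [Matrix.trace, Matrix.mul_apply, Fintype.sum_prod_type, Fin.sum_univ_two,
      choiMatrix_apply, qubitMap, Matrix.single_apply, pauliX]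
  norm_num

/-- The probabilities of the qubit process. -/
def qubitValue (a b x y : Fin 2) : ℝ :=
  1 / 4 * (!![0, 2; 1, 1] a x * !![0, 2; 1, 1] b y + 1 / Real.sqrt 2 *
    (!![0, 2; 1, -1] a x * !![0, 0; 1, -1] b y + !![0, 0; 1, -1] a x * !![0, 2; 0, 0] b y))

/-- All traces factorize over the parties, and the `n` idle channels contribute `2 ^ n` to each
term, so the result is independent of `n`. -/
theorem quantumForm_bystanderW (n : ℕ) (a b x y : Fin 2) :
    quantumForm (bystanderW n) (pairFamily n (choiMatrix (qubitMap a x))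
      (choiMatrix (qubitMap b y)) (choiMatrix LinearMap.id)) = (qubitValue a b x y : ℂ) := by
  have hid : (choiMatrix (LinearMap.id : Matrix (Fin 2) (Fin 2) ℂ →ₗ[ℂ] _)).trace = 2 := by
    simpa [qubitMap] using trace_choiMatrix_qubitMap 0 1
  have hmap : ∀ (F : QubitOperator → QubitOperator → ℂ) (A A' A'' X X' X'' : QubitOperator),
      ∏ k, F (pairFamily n A A' A'' k) (pairFamily n X X' X'' k) =
        F A X * (F A' X' * F A'' X'' ^ n) := by
    intro F A A' A'' X X' X''
    rw [← prod_pairFamily]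
    refine Finset.prod_congr rfl fun k _ => ?_
    unfold pairFamily
    split_ifs <;> rfl
  have h2 : (2 : ℂ) ^ n ≠ 0 := by positivity
  rw [quantumForm_apply, bystanderW, smul_mul_assoc, add_mul, one_mul, smul_mul_assoc, add_mul,
    tensorOperator_mul, tensorOperator_mul, Matrix.trace_smul, Matrix.trace_add, Matrix.trace_smul,
    Matrix.trace_add, trace_tensorOperator, trace_tensorOperator, trace_tensorOperator]
  unfold leftOps rightOps
  rw [hmap fun A X => (A * X).trace, hmap fun A X => (A * X).trace,
    hmap (fun _ X => X.trace) 0 0 0]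
  simp only [one_mul, hid, trace_choiMatrix_qubitMap, trace_zz_mul_choiMatrix_qubitMap,
    trace_z_mul_choiMatrix_qubitMap, trace_xx_mul_choiMatrix_qubitMap]
  rw [qubitValue, pow_add]
  fin_cases a <;> fin_cases x <;> fin_cases b <;> fin_cases y <;> simp <;>
    field_simp <;> norm_num <;> ring

/-! ### The violation of the bipartite causal inequalities -/

theorem qubit_violation : ∃ p ∈ QP 2 2 2,
    (∀ x a, (p.prob x a : ℂ) = quantumProb qubitW (fun _ => qubitMap) x a) ∧
    gyni p = 5 / 16 * (1 + 1 / Real.sqrt 2) ∧ 1 / 2 < gyni p ∧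
    lgyni p = 1 / 4 + 5 / 16 * (1 + 1 / Real.sqrt 2) ∧ 3 / 4 < lgyni p := by
  obtain ⟨p, hp⟩ := exists_quantumCorrelation (M := 2) (D := 2) isProcessMatrix_qubitW
    (Φ := fun _ => qubitMap) fun _ a => isInstrument_qubitMap a
  have hval : ∀ x y a b, p.prob ![x, y] ![a, b] = qubitValue a b x y := fun x y a b => by
    rw [← Complex.ofReal_inj, hp, ← quantumForm_bystanderW 0, quantumProb_eq_quantumForm,
      bystanderW_zero]
    congr 1
    funext k
    fin_cases k <;> rfl
  have h1 : gyni p = 5 / 16 * (1 + 1 / Real.sqrt 2) := by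
    rw [gyni_eq]
    simp [hval, qubitValue]
    ring
  have h2 : lgyni p = 1 / 4 + 5 / 16 * (1 + 1 / Real.sqrt 2) := by
    rw [lgyni_eq]
    simp [hval, qubitValue]
    ring
  -- Both violations amount to `5 / 16 * (1 + 1 / √2) > 1 / 2`, that is to this inequality.
  have h3 : 3 / 5 < 1 / Real.sqrt 2 := by
    rw [lt_div_iff₀ (by positivity)]
    nlinarith [Real.sq_sqrt (zero_le_two (α := ℝ)), Real.sqrt_nonneg 2]
  refine ⟨p, ⟨fun _ => 2, fun _ => 2, fun _ => two_pos, fun _ => two_pos, qubitW,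
    isProcessMatrix_qubitW, fun _ => qubitMap, fun _ a => isInstrument_qubitMap a, hp⟩, hp, h1, ?_,
    h2, ?_⟩
  · rw [h1]
    linarith
  · rw [h2]
    linarith

/-! ### A bound on two-way signalling in classical processes -/

theorem eq_sum_single_single {ι κ : Type*} [Fintype ι] [DecidableEq ι] [Fintype κ]
    [DecidableEq κ] (X : ι → κ → ℝ) : X = ∑ i, ∑ o, X i o • Pi.single i (Pi.single o 1) := by
  funext i o
  simp only [Finset.sum_apply, Pi.smul_apply, smul_eq_mul]
  rw [Finset.sum_eq_single i, Finset.sum_eq_single o]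
  · simp
  · intro u _ hu
    simp [hu.symm]
  · simp
  · intro j _ hj
    simp [hj.symm]
  · simp

theorem single_single_nonneg {ι κ : Type*} [DecidableEq ι] [DecidableEq κ] (i : ι) (o : κ) (i' : ι)
    (o' : κ) : 0 ≤ (Pi.single i (Pi.single o 1) : ι → κ → ℝ) i' o' := by
  by_cases h : i' = i
  · subst h
    by_cases h' : o' = o
    · subst h'
      simp
    · simp [h']
  · simp [h]

/-- The values of the form on matrix units play the role of a bipartite environment, so the ordered
decomposition also applies to a process with its bystanders fixed. -/
theorem bilin_expand {ι κ ι' κ' : Type*} [Fintype ι] [DecidableEq ι] [Fintype κ] [DecidableEq κ]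
    [Fintype ι'] [DecidableEq ι'] [Fintype κ'] [DecidableEq κ']
    (β : (ι → κ → ℝ) →ₗ[ℝ] (ι' → κ' → ℝ) →ₗ[ℝ] ℝ) (X : ι → κ → ℝ) (Y : ι' → κ' → ℝ) :
    β X Y = ∑ i, ∑ o, ∑ j, ∑ u, X i o * Y j u *
      β (Pi.single i (Pi.single o 1)) (Pi.single j (Pi.single u 1)) := by
  have hY : ∀ T : (ι' → κ' → ℝ) →ₗ[ℝ] ℝ,
      T Y = ∑ j, ∑ u, Y j u * T (Pi.single j (Pi.single u 1)) := fun T => by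
    conv_lhs => rw [eq_sum_single_single Y]
    simp only [map_sum, map_smul, smul_eq_mul]
  conv_lhs => rw [eq_sum_single_single X]
  simp only [map_sum, map_smul, LinearMap.sum_apply, LinearMap.smul_apply, smul_eq_mul]
  simp only [hY, Finset.mul_sum, mul_assoc]

/-- Discarding the substochastic array of the second party leaves the first party's weight, since
`α` has the marginal `a i` for every output `o`. -/
theorem ordered_bound {ι κ ι' κ' : Type*} [Fintype ι] [Fintype κ] [Fintype ι'] [Fintype κ']
    {α : ι → ι' → κ → ℝ} {a : ι → ℝ} (hα : ∀ i j o, 0 ≤ α i j o) (ha : ∀ i o, ∑ j, α i j o = a i)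
    {X : ι → κ → ℝ} {Y : ι' → κ' → ℝ} (hX : ∀ i o, 0 ≤ X i o) (hY : ∀ j, ∑ u, Y j u ≤ 1) :
    ∑ i, ∑ o, ∑ j, ∑ u, X i o * Y j u * α i j o ≤ ∑ i, ∑ o, X i o * a i := by
  refine Finset.sum_le_sum fun i _ => Finset.sum_le_sum fun o _ => ?_
  rw [← ha i o, Finset.mul_sum]
  refine Finset.sum_le_sum fun j _ => ?_
  simp_rw [mul_right_comm _ _ (α i j o)]
  rw [← Finset.mul_sum]
  exact mul_le_of_le_one_right (mul_nonneg (hX _ _) (hα _ _ _)) (hY j)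

/-- In each ordered part the winning probability is at most the probability that the first party
guesses right. For each of its settings the two guesses share at most the weight of that part, so
the two settings and the two parts give at most `2 (∑ a + ∑ b) = 2`. -/
theorem two_way_bound {ι κ ι' κ' : Type*} [Fintype ι] [DecidableEq ι] [Fintype κ] [DecidableEq κ]
    [Fintype ι'] [DecidableEq ι'] [Fintype κ'] [DecidableEq κ'] [Nonempty κ] [Nonempty κ']
    {β : (ι → κ → ℝ) →ₗ[ℝ] (ι' → κ' → ℝ) →ₗ[ℝ] ℝ}
    (hpos : ∀ X Y, (∀ i o, 0 ≤ X i o) → (∀ j u, 0 ≤ Y j u) → 0 ≤ β X Y)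
    (hone : ∀ X Y, (∀ i, ∑ o, X i o = 1) → (∀ j, ∑ u, Y j u = 1) → β X Y = 1)
    {X : Fin 2 → Fin 2 → ι → κ → ℝ} {Y : Fin 2 → Fin 2 → ι' → κ' → ℝ}
    (hX : ∀ s t i o, 0 ≤ X s t i o) (hY : ∀ s t j u, 0 ≤ Y s t j u)
    (hX1 : ∀ s i, ∑ o, (X s 0 i o + X s 1 i o) ≤ 1)
    (hY1 : ∀ s j, ∑ u, (Y s 0 j u + Y s 1 j u) ≤ 1) :
    ∑ s, ∑ t, β (X s t) (Y t s) ≤ 2 := by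
  obtain ⟨α, γ, a, b, hα, hγ, hsum, ha, hb, hab⟩ := exists_ordered_decomposition
    (fun i j o u => β (Pi.single i (Pi.single o 1)) (Pi.single j (Pi.single u 1)))
    (fun i j o u => hpos _ _ (single_single_nonneg i o) (single_single_nonneg j u)) (fun f g => by
      refine Eq.trans ?_ (hone (fun i o => if o = f i then 1 else 0)
        (fun j u => if u = g j then 1 else 0) (fun i => by simp) (fun j => by simp))
      rw [bilin_expand β]
      refine Finset.sum_congr rfl fun i _ => ?_
      rw [Finset.sum_eq_single (f i)]
      · refine Finset.sum_congr rfl fun j _ => ?_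
        rw [Finset.sum_eq_single (g j)]
        · simp
        · intro u _ hu
          simp [hu]
        · simp
      · intro o _ ho
        simp [ho]
      · simp)
  have ha0 : ∀ i, 0 ≤ a i := fun i => by
    rw [← ha i (Classical.arbitrary κ)]
    exact Finset.sum_nonneg fun j _ => hα _ _ _
  have hb0 : ∀ j, 0 ≤ b j := fun j => by
    rw [← hb j (Classical.arbitrary κ')]
    exact Finset.sum_nonneg fun j _ => hγ _ _ _
  have hX2 : ∀ s t i, ∑ o, X s t i o ≤ 1 := fun s t i => (Finset.sum_le_sum fun o _ => by
    have h0 := hX s 0 i o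
    have h1 := hX s 1 i o
    fin_cases t <;> simp only [Fin.zero_eta, Fin.mk_one] <;> linarith).trans (hX1 s i)
  have hY2 : ∀ s t j, ∑ u, Y s t j u ≤ 1 := fun s t i => (Finset.sum_le_sum fun o _ => by
    have h0 := hY s 0 i o
    have h1 := hY s 1 i o
    fin_cases t <;> simp only [Fin.zero_eta, Fin.mk_one] <;> linarith).trans (hY1 s i)
  have hle : ∀ s t, β (X s t) (Y t s) ≤
      ∑ i, ∑ o, X s t i o * a i + ∑ j, ∑ u, Y t s j u * b j := by
    intro s t
    rw [bilin_expand β]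
    simp_rw [hsum, mul_add, Finset.sum_add_distrib]
    refine add_le_add (ordered_bound hα ha (hX s t) (hY2 t s)) ?_
    refine le_trans (le_of_eq ?_) (ordered_bound (α := fun j i u => γ i j u)
      (fun _ _ _ => hγ _ _ _) hb (hY t s) (hX2 s t))
    have h1 : ∀ i, ∑ o, ∑ j, ∑ u, X s t i o * Y t s j u * γ i j u =
        ∑ j, ∑ u, ∑ o, Y t s j u * X s t i o * γ i j u := fun i => by
      rw [Finset.sum_comm]
      refine Finset.sum_congr rfl fun j _ => ?_
      rw [Finset.sum_comm]
      refine Finset.sum_congr rfl fun u _ => Finset.sum_congr rfl fun o _ => ?_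
      rw [mul_comm (X s t i o)]
    simp_rw [h1]
    rw [Finset.sum_comm]
    refine Finset.sum_congr rfl fun j _ => ?_
    rw [Finset.sum_comm]
  have hsumX : ∀ s, ∑ i, ∑ o, X s 0 i o * a i + ∑ i, ∑ o, X s 1 i o * a i ≤ ∑ i, a i := by
    intro s
    rw [← Finset.sum_add_distrib]
    refine Finset.sum_le_sum fun i _ => ?_
    rw [← Finset.sum_add_distrib]
    simp_rw [← add_mul]
    rw [← Finset.sum_mul]
    exact mul_le_of_le_one_left (ha0 i) (hX1 s i)
  have hsumY : ∀ s, ∑ i, ∑ o, Y s 0 i o * b i + ∑ i, ∑ o, Y s 1 i o * b i ≤ ∑ i, b i := by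
    intro s
    rw [← Finset.sum_add_distrib]
    refine Finset.sum_le_sum fun i _ => ?_
    rw [← Finset.sum_add_distrib]
    simp_rw [← add_mul]
    rw [← Finset.sum_mul]
    exact mul_le_of_le_one_left (hb0 i) (hY1 s i)
  simp only [Fin.sum_univ_two]
  linarith [hle 0 0, hle 0 1, hle 1 0, hle 1 1, hsumX 0, hsumX 1, hsumY 0, hsumY 1]

theorem two_way_bound_of_mem_PC {n M D : ℕ} (hM : 2 ≤ M) (hD : 2 ≤ D)
    {p : Correlation (n + 2) M D} (hp : p ∈ PC (n + 2) M D) :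
    ∑ s, ∑ t, p.prob (pairFamily n (Fin.castLE hD t) (Fin.castLE hD s) (Fin.castLE hD 0))
      (pairFamily n (Fin.castLE hM s) (Fin.castLE hM t) (Fin.castLE hM 0)) ≤ 2 := by
  obtain ⟨dI, dO, hI, hO, P, hP, L, hL⟩ := hp
  have hP' := isClassicalProcess_iff.1 hP
  let m : Fin 2 → Fin M := Fin.castLE hM
  let e : Fin 2 → Fin D := Fin.castLE hD
  have he : (e 0) ≠ e 1 := by simp [e]
  have : Nonempty (Fin (dO 0)) := ⟨⟨0, hO 0⟩⟩
  have : Nonempty (Fin (dO 1)) := ⟨⟨0, hO 1⟩⟩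
  let C : (k : Fin (n + 2)) → Fin (dI k) → Fin (dO k) → ℝ :=
    fun k i o => ∑ x, (L k).prob x o (m 0) i
  have hC0 : ∀ k i o, 0 ≤ C k i o := fun k i o => Finset.sum_nonneg fun x _ => (L k).nonneg _ _ _ _
  have hC1 : ∀ k i, ∑ o, C k i o = 1 := fun k i => by
    rw [← (L k).sum_one (m 0) i]
    exact Finset.sum_comm
  have hsub : ∀ k a i, ∑ o, ((L k).prob (e 0) o a i + (L k).prob (e 1) o a i) ≤ 1 := by
    intro k a i
    rw [Finset.sum_add_distrib, ← (L k).sum_one a i, ← Finset.sum_pair (f := fun x => ∑ o, (L k).prob x o a i) he]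
    exact Finset.sum_le_sum_of_subset_of_nonneg (Finset.subset_univ _) fun x _ _ =>
      Finset.sum_nonneg fun o _ => (L k).nonneg _ _ _ _
  -- Replacing the bystanders' outcome `0` by the sum over all outcomes only increases the value,
  -- and makes their arrays stochastic.
  refine le_trans (Finset.sum_le_sum fun s _ => Finset.sum_le_sum fun t _ => ?_)
    (two_way_bound (β := (processForm P).pairForm C) (fun X Y hX hY => ?_) (fun X Y hX hY => ?_)
      (X := fun s t i o => (L 0).prob (e t) o (m s) i)
      (Y := fun s t i o => (L 1).prob (e t) o (m s) i)
      (fun _ _ _ _ => (L 0).nonneg _ _ _ _) (fun _ _ _ _ => (L 1).nonneg _ _ _ _)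
      (fun _ _ => hsub _ _ _) (fun _ _ => hsub _ _ _))
  · rw [hL, classicalProb_eq_processForm, MultilinearMap.pairForm_apply]
    refine processForm_mono hP'.1 (fun k i o => (L k).nonneg _ _ _ _) fun k => ?_
    by_cases h1 : k = 1
    · subst h1
      intro i o
      simp only [pairFamily_one, Function.update_self]
      exact le_rfl
    · rw [Function.update_of_ne h1]
      by_cases h0 : k = 0
      · subst h0
        intro i o
        simp only [pairFamily_zero, Function.update_self]
        exact le_rfl
      · rw [Function.update_of_ne h0, pairFamily_of_ne _ _ _ h0 h1, pairFamily_of_ne _ _ _ h0 h1]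
        exact fun i o => Finset.single_le_sum
          (f := fun x => (L k).prob x o (m 0) i) (fun x _ => (L k).nonneg _ _ _ _)
          (Finset.mem_univ (e 0))
  · exact processForm_nonneg hP'.1 (forall_update_update
      (q := fun k (F : Fin (dI k) → Fin (dO k) → ℝ) => ∀ i o, 0 ≤ F i o) hC0 hX hY)
  · exact processForm_eq_one hP'.2 (forall_update_update
      (q := fun k (F : Fin (dI k) → Fin (dO k) → ℝ) => ∀ i, ∑ o, F i o = 1) hC1 hX hY)

/-! ### Quantum process correlations that are not classical -/

/-- An instrument with two outcomes as an instrument with `D ≥ 2` outcomes. -/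
def extendOutcomes {dI dO : ℕ} (D : ℕ)
    (Φ : Fin 2 → (Matrix (Fin dI) (Fin dI) ℂ →ₗ[ℂ] Matrix (Fin dO) (Fin dO) ℂ)) (x : Fin D) :
    Matrix (Fin dI) (Fin dI) ℂ →ₗ[ℂ] Matrix (Fin dO) (Fin dO) ℂ :=
  if h : x.val < 2 then Φ ⟨x.val, h⟩ else 0

theorem extendOutcomes_castLE {dI dO D : ℕ} (hD : 2 ≤ D)
    (Φ : Fin 2 → (Matrix (Fin dI) (Fin dI) ℂ →ₗ[ℂ] Matrix (Fin dO) (Fin dO) ℂ)) (x : Fin 2) :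
    extendOutcomes D Φ (Fin.castLE hD x) = Φ x := by
  exact dif_pos x.isLt

theorem IsInstrument.extend {dI dO D : ℕ} (hD : 2 ≤ D)
    {Φ : Fin 2 → (Matrix (Fin dI) (Fin dI) ℂ →ₗ[ℂ] Matrix (Fin dO) (Fin dO) ℂ)}
    (hΦ : IsInstrument Φ) : IsInstrument (extendOutcomes D Φ) := by
  refine ⟨fun x => ?_, fun ρ => ?_⟩
  · unfold extendOutcomes
    split_ifs
    · exact hΦ.1 _
    · exact isCompletelyPositive_zero
  · rw [← hΦ.2 ρ]
    congr 1
    refine (Fintype.sum_of_injective (Fin.castLE hD) (Fin.castLE_injective hD) _ _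
      (fun x hx => ?_) fun x => ?_).symm
    · rw [extendOutcomes, dif_neg fun h => hx ⟨⟨x.val, h⟩, rfl⟩, LinearMap.zero_apply]
    · rw [extendOutcomes_castLE]

/-- The identity channel with outcome `0`. -/
def idleMap (x : Fin 2) : Matrix (Fin 2) (Fin 2) ℂ →ₗ[ℂ] Matrix (Fin 2) (Fin 2) ℂ :=
  if x = 0 then LinearMap.id else 0

theorem isInstrument_idleMap : IsInstrument idleMap := by
  refine ⟨fun x => ?_, fun ρ => ?_⟩
  · unfold idleMap
    split_ifs
    · exact isCompletelyPositive_id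
    · exact isCompletelyPositive_zero
  · simp [idleMap]

/-- Parties `0` and `1` use `qubitMap`, and the other parties are idle. -/
def bystanderMap (n M D : ℕ) (k : Fin (n + 2)) (a : Fin M) (x : Fin D) :
    Matrix (Fin 2) (Fin 2) ℂ →ₗ[ℂ] Matrix (Fin 2) (Fin 2) ℂ :=
  extendOutcomes D (pairFamily n (qubitMap (if a.val = 0 then 0 else 1))
    (qubitMap (if a.val = 0 then 0 else 1)) idleMap k) x

theorem isInstrument_bystanderMap (n : ℕ) {M D : ℕ} (hD : 2 ≤ D) (k : Fin (n + 2)) (a : Fin M) :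
    IsInstrument (bystanderMap n M D k a) := by
  refine IsInstrument.extend hD ?_
  unfold pairFamily
  split_ifs
  exacts [isInstrument_qubitMap _, isInstrument_qubitMap _, isInstrument_qubitMap _,
    isInstrument_qubitMap _, isInstrument_idleMap]

theorem quantumProb_bystander (n : ℕ) {M D : ℕ} (hM : 2 ≤ M) (hD : 2 ≤ D) (s t x y : Fin 2) :
    quantumProb (bystanderW n) (bystanderMap n M D)
      (pairFamily n (Fin.castLE hD x) (Fin.castLE hD y) (Fin.castLE hD 0))
      (pairFamily n (Fin.castLE hM s) (Fin.castLE hM t) (Fin.castLE hM 0)) =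
        (qubitValue s t x y : ℂ) := by
  have hbit : ∀ s : Fin 2, (if (Fin.castLE hM s).val = 0 then (0 : Fin 2) else 1) = s := by
    intro s
    fin_cases s <;> simp
  rw [quantumProb_eq_quantumForm, ← quantumForm_bystanderW n]
  congr 1
  funext k
  unfold bystanderMap pairFamily
  by_cases h0 : k = 0
  · simp only [h0, if_true]
    rw [hbit, extendOutcomes_castLE]
  · by_cases h1 : k = 1
    · simp only [h1, if_true, one_ne_zero, if_false]
      rw [hbit, extendOutcomes_castLE]
    · simp only [h0, h1, if_false]
      rw [extendOutcomes_castLE]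
      rfl

theorem PC_ssubset_QP {n M D : ℕ} (hM : 2 ≤ M) (hD : 2 ≤ D) : PC (n + 2) M D ⊂ QP (n + 2) M D := by
  obtain ⟨p, hp⟩ := exists_quantumCorrelation (isProcessMatrix_bystanderW n)
    (Φ := bystanderMap n M D) (isInstrument_bystanderMap n hD)
  refine (Set.ssubset_iff_of_subset (PC_subset_QP _ _ _)).2 ⟨p, ⟨fun _ => 2, fun _ => 2,
    fun _ => two_pos, fun _ => two_pos, bystanderW n, isProcessMatrix_bystanderW n,
    bystanderMap n M D, isInstrument_bystanderMap n hD, hp⟩, fun hPC => ?_⟩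
  have h1 := two_way_bound_of_mem_PC hM hD hPC
  have hval : ∀ s t : Fin 2,
      p.prob (pairFamily n (Fin.castLE hD t) (Fin.castLE hD s) (Fin.castLE hD 0))
        (pairFamily n (Fin.castLE hM s) (Fin.castLE hM t) (Fin.castLE hM 0)) =
      qubitValue s t t s := fun s t => by
    rw [← Complex.ofReal_inj, hp, quantumProb_bystander]
  simp only [hval, Fin.sum_univ_two] at h1
  have h3 : 3 / 5 < 1 / Real.sqrt 2 := by
    rw [lt_div_iff₀ (by positivity)]
    nlinarith [Real.sq_sqrt (zero_le_two (α := ℝ)), Real.sqrt_nonneg 2]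
  -- The four values sum to `5 / 4 * (1 + 1 / √2)`, which exceeds 2 because `1 / √2 > 3 / 5`.
  simp [qubitValue] at h1 h3
  linarith

/-! ### Three distinguished parties among `n + 3` -/

/-- The family with values `s`, `t`, `v` at parties `0`, `1`, `2`, and `u` at all other parties. -/
def tripleFamily {α : Type*} (n : ℕ) (s t v u : α) : Fin (n + 3) → α :=
  fun k => if k = 0 then s else if k = 1 then t else if k = 2 then v else u

theorem fin_two_ne_zero (n : ℕ) : (2 : Fin (n + 3)) ≠ 0 := by
  simp [Fin.ext_iff, Nat.mod_eq_of_lt (show 2 < n + 3 by omega)]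

theorem fin_two_ne_one (n : ℕ) : (2 : Fin (n + 3)) ≠ 1 := by
  simp [Fin.ext_iff, Nat.mod_eq_of_lt (show 2 < n + 3 by omega)]

@[simp] theorem tripleFamily_zero {α : Type*} (n : ℕ) (s t v u : α) :
    tripleFamily n s t v u 0 = s := rfl

@[simp] theorem tripleFamily_one {α : Type*} (n : ℕ) (s t v u : α) :
    tripleFamily n s t v u 1 = t := by
  simp [tripleFamily]

@[simp] theorem tripleFamily_two {α : Type*} (n : ℕ) (s t v u : α) :
    tripleFamily n s t v u 2 = v := by
  simp [tripleFamily, fin_two_ne_zero, fin_two_ne_one]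

theorem tripleFamily_of_ne {α : Type*} {n : ℕ} (s t v u : α) {k : Fin (n + 3)} (h0 : k ≠ 0)
    (h1 : k ≠ 1) (h2 : k ≠ 2) : tripleFamily n s t v u k = u := by
  simp [tripleFamily, h0, h1, h2]

theorem forall_eq_or_ne_triple {n : ℕ} {q : Fin (n + 3) → Prop} (h0 : q 0) (h1 : q 1) (h2 : q 2)
    (h : ∀ k, k ≠ 0 → k ≠ 1 → k ≠ 2 → q k) (k : Fin (n + 3)) : q k := by
  by_cases hk0 : k = 0
  · exact hk0 ▸ h0
  by_cases hk1 : k = 1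
  · exact hk1 ▸ h1
  by_cases hk2 : k = 2
  · exact hk2 ▸ h2
  exact h k hk0 hk1 hk2

theorem tripleFamily_inj {α : Type*} {n : ℕ} {s t v u s' t' v' : α} :
    tripleFamily n s t v u = tripleFamily n s' t' v' u ↔ s = s' ∧ t = t' ∧ v = v' := by
  constructor
  · intro h
    refine ⟨?_, ?_, ?_⟩
    · simpa using congrFun h 0
    · simpa using congrFun h 1
    · simpa using congrFun h 2
  · rintro ⟨rfl, rfl, rfl⟩
    rfl

/-! ### Cyclic guessing is impossible for process functions -/

/-- Some of the Boolean functions of two bits. -/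
def bitFunction (c : Fin 6) (u v : Bool) : Bool :=
  match c with
  | 0 => false
  | 1 => true
  | 2 => u
  | 3 => !u
  | 4 => v
  | 5 => !v

/-- Whether `(b₀, b₁, b₂)` is consistent with parties who choose their bits by the functions
`bitFunction c` of their two possible guesses. -/
def isLoopFixedPoint (g : Bool → Bool → Bool → Bool) (c : Fin 6 × Fin 6 × Fin 6)
    (b : Bool × Bool × Bool) : Bool :=
  (bitFunction c.1 (xor b.2.2 (g false b.2.1 b.2.2)) (xor b.2.2 (g true b.2.1 b.2.2)) == b.1) &&
  (bitFunction c.2.1 (xor b.1 (g b.1 false b.2.2)) (xor b.1 (g b.1 true b.2.2)) == b.2.1) &&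
  (bitFunction c.2.2 (xor b.2.1 (g b.1 b.2.1 false)) (xor b.2.1 (g b.1 b.2.1 true)) == b.2.2)

/-- Truth tables turn the quantification over `g` into one over eight bits, which is decidable by
evaluation. -/
def boolTable (t : Bool × Bool × Bool × Bool × Bool × Bool × Bool × Bool) (a b c : Bool) : Bool :=
  bif a then (bif b then (bif c then t.1 else t.2.1) else (bif c then t.2.2.1 else t.2.2.2.1))
  else (bif b then (bif c then t.2.2.2.2.1 else t.2.2.2.2.2.1)
    else (bif c then t.2.2.2.2.2.2.1 else t.2.2.2.2.2.2.2))

/-- Eight triples of strategies suffice for all 256 functions `g`, as `hasLoopPair_boolTable`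
confirms. -/
def loopChoices : List (Fin 6 × Fin 6 × Fin 6) :=
  [(5, 3, 3), (5, 2, 3), (4, 0, 3), (4, 5, 2), (0, 5, 3), (4, 4, 5), (2, 4, 4), (4, 3, 2)]

def bitTriples : List (Bool × Bool × Bool) :=
  [(false, false, false), (false, false, true), (false, true, false), (false, true, true),
    (true, false, false), (true, false, true), (true, true, false), (true, true, true)]

def hasLoopPair (g : Bool → Bool → Bool → Bool) : Bool :=
  loopChoices.any fun c => bitTriples.any fun b => isLoopFixedPoint g c b &&
    bitTriples.any fun b' => b != b' && isLoopFixedPoint g c b'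

theorem hasLoopPair_boolTable : ∀ t1 t2 t3 t4 t5 t6 t7 t8 : Bool,
    hasLoopPair (boolTable (t1, t2, t3, t4, t5, t6, t7, t8)) = true := by
  decide +kernel

/-- The combinatorial core: whatever common flip `g` accompanies the cyclic guesses, some local rule
for choosing the bits from the guesses has two self-consistent solutions. -/
theorem exists_two_loopFixedPoints (g : Bool → Bool → Bool → Bool) :
    ∃ c b b', b ≠ b' ∧ isLoopFixedPoint g c b = true ∧ isLoopFixedPoint g c b' = true := by
  have h1 := hasLoopPair_boolTable (g true true true) (g true true false) (g true false true)
    (g true false false) (g false true true) (g false true false) (g false false true)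
    (g false false false)
  have h2 : boolTable (g true true true, g true true false, g true false true,
    g true false false, g false true true, g false true false, g false false true,
    g false false false) = g := by
    funext a b c
    cases a <;> cases b <;> cases c <;> rfl
  rw [h2] at h1
  simp only [hasLoopPair, List.any_eq_true, Bool.and_eq_true, bne_iff_ne] at h1
  obtain ⟨c, -, b, -, hb, b', -, hne, hb'⟩ := h1
  exact ⟨c, b, b', hne, hb, hb'⟩

/-- The outcome bits `x` are the cyclically shifted setting bits `b` or their negations. -/
def IsShiftOrNot (x₀ x₁ x₂ b₀ b₁ b₂ : Bool) : Prop :=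
  ∃ g, x₀ = xor b₂ g ∧ x₁ = xor b₀ g ∧ x₂ = xor b₁ g

theorem IsProcessFunction.exists_not_isShiftOrNot {n : ℕ} {dI dO : Fin (n + 3) → ℕ}
    {ω : ((k : Fin (n + 3)) → Fin (dO k)) → ((k : Fin (n + 3)) → Fin (dI k))}
    (hω : IsProcessFunction ω) (X : (k : Fin (n + 3)) → Bool → Fin (dI k) → Bool)
    (O : (k : Fin (n + 3)) → Bool → Fin (dI k) → Fin (dO k)) :
    ∃ (b : Fin (n + 3) → Bool) (i : (k : Fin (n + 3)) → Fin (dI k)),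
      i = ω (fun k => O k (b k) (i k)) ∧
      ¬IsShiftOrNot (X 0 (b 0) (i 0)) (X 1 (b 1) (i 1)) (X 2 (b 2) (i 2)) (b 0) (b 1) (b 2) := by
  rw [isProcessFunction_iff] at hω
  by_contra! hcon
  -- If all fixed points were good, each setting vector `b` would have a fixed point `I b` and a
  -- flip `G b` with the outcomes equal to the shifted bits plus `G b`.
  choose I hI _ using fun b : Fin (n + 3) → Bool => hω fun k => O k (b k)
  choose G hG using fun b => hcon b (I b) (hI b)
  -- A self-consistent choice of settings from inputs makes `I b` a fixed point for the
  -- interventions `i ↦ O k (ψ k i) i`, which do not mention `b`; uniqueness of that point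
  -- determines `b`.
  have uniq : ∀ (ψ : (k : Fin (n + 3)) → Fin (dI k) → Bool) (b b' : Fin (n + 3) → Bool),
      (∀ k, ψ k (I b k) = b k) → (∀ k, ψ k (I b' k) = b' k) → b = b' := by
    intro ψ b b' h h'
    have hfix : ∀ b, (∀ k, ψ k (I b k) = b k) →
        I b = ω fun k => O k (ψ k (I b k)) (I b k) := fun b h => by
      simp_rw [h]
      exact hI b
    have := (hω fun k i => O k (ψ k i) i).unique (hfix b h) (hfix b' h')
    funext k
    rw [← h, ← h', this]
  -- No party signals to itself: otherwise party `j` could recognize `I b j` and choose `b j` there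
  -- and `c` elsewhere, which is self-consistent for both setting vectors.
  have indep : ∀ b j c, I (Function.update b j c) j = I b j := by
    intro b j c
    by_contra hne
    have hc : b j ≠ c := by
      rintro rfl
      exact hne (by rw [Function.update_eq_self])
    have := uniq (Function.update (fun k _ => b k) j fun i => if i = I b j then b j else c) b
      (Function.update b j c) (fun k => ?_) fun k => ?_
    · exact hc (by simpa using congrFun this j)
    · by_cases hk : k = j
      · subst hk
        simp
      · simp [Function.update_of_ne hk]
    · by_cases hk : k = j
      · subst hk
        simp [hne]
      · simp [Function.update_of_ne hk]
  let tri : Bool → Bool → Bool → Fin (n + 3) → Bool := fun b₀ b₁ b₂ =>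
    tripleFamily n b₀ b₁ b₂ false
  have hu0 : ∀ b₀ b₁ b₂ s, Function.update (tri b₀ b₁ b₂) 0 s = tri s b₁ b₂ := by
    intro b₀ b₁ b₂ s
    refine funext (forall_eq_or_ne_triple ?_ ?_ ?_ fun k h0 h1 h2 => ?_)
    · simp [tri]
    · simp [tri]
    · simp [tri, Function.update_of_ne (fin_two_ne_zero n)]
    · rw [Function.update_of_ne h0]
      simp [tri, tripleFamily_of_ne _ _ _ _ h0 h1 h2]
  have hu1 : ∀ b₀ b₁ b₂ s, Function.update (tri b₀ b₁ b₂) 1 s = tri b₀ s b₂ := by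
    intro b₀ b₁ b₂ s
    refine funext (forall_eq_or_ne_triple ?_ ?_ ?_ fun k h0 h1 h2 => ?_)
    · simp [tri]
    · simp [tri]
    · simp [tri, Function.update_of_ne (fin_two_ne_one n)]
    · rw [Function.update_of_ne h1]
      simp [tri, tripleFamily_of_ne _ _ _ _ h0 h1 h2]
  have hu2 : ∀ b₀ b₁ b₂ s, Function.update (tri b₀ b₁ b₂) 2 s = tri b₀ b₁ s := by
    intro b₀ b₁ b₂ s
    refine funext (forall_eq_or_ne_triple ?_ ?_ ?_ fun k h0 h1 h2 => ?_)
    · simp [tri, Function.update_of_ne (fin_two_ne_zero n).symm]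
    · simp [tri, Function.update_of_ne (fin_two_ne_one n).symm]
    · simp [tri]
    · rw [Function.update_of_ne h2]
      simp [tri, tripleFamily_of_ne _ _ _ _ h0 h1 h2]
  -- By `indep` the same input occurs for both own settings, so a party can evaluate its guess for
  -- each of them, with the flip belonging to the altered setting vector.
  have hX0 : ∀ b₀ b₁ b₂ s, X 0 s (I (tri b₀ b₁ b₂) 0) = xor b₂ (G (tri s b₁ b₂)) := by
    intro b₀ b₁ b₂ s
    rw [← indep _ 0 s, hu0]
    simpa [tri] using (hG (tri s b₁ b₂)).1
  have hX1 : ∀ b₀ b₁ b₂ s, X 1 s (I (tri b₀ b₁ b₂) 1) = xor b₀ (G (tri b₀ s b₂)) := by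
    intro b₀ b₁ b₂ s
    rw [← indep _ 1 s, hu1]
    simpa [tri] using (hG (tri b₀ s b₂)).2.1
  have hX2 : ∀ b₀ b₁ b₂ s, X 2 s (I (tri b₀ b₁ b₂) 2) = xor b₁ (G (tri b₀ b₁ s)) := by
    intro b₀ b₁ b₂ s
    rw [← indep _ 2 s, hu2]
    simpa [tri] using (hG (tri b₀ b₁ s)).2.2
  obtain ⟨c, b, b', hne, hb, hb'⟩ := exists_two_loopFixedPoints fun b₀ b₁ b₂ => G (tri b₀ b₁ b₂)
  -- The local rules `ψ` apply the strategies `c` to these pairs of guesses; bystanders always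
  -- choose `false`.
  have hψ : ∀ b, isLoopFixedPoint (fun b₀ b₁ b₂ => G (tri b₀ b₁ b₂)) c b = true → ∀ k,
      (if k = 0 then bitFunction c.1 (X k false (I (tri b.1 b.2.1 b.2.2) k))
          (X k true (I (tri b.1 b.2.1 b.2.2) k))
        else if k = 1 then bitFunction c.2.1 (X k false (I (tri b.1 b.2.1 b.2.2) k))
          (X k true (I (tri b.1 b.2.1 b.2.2) k))
        else if k = 2 then bitFunction c.2.2 (X k false (I (tri b.1 b.2.1 b.2.2) k))
          (X k true (I (tri b.1 b.2.1 b.2.2) k)) else false) = tri b.1 b.2.1 b.2.2 k := by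
    intro b hb
    simp only [isLoopFixedPoint, Bool.and_eq_true, beq_iff_eq] at hb
    refine forall_eq_or_ne_triple ?_ ?_ ?_ fun k h0 h1 h2 => ?_
    · rw [if_pos rfl, hX0, hX0]
      exact hb.1.1
    · rw [if_neg one_ne_zero, if_pos rfl, hX1, hX1, hb.1.2]
      exact (tripleFamily_one _ _ _ _ _).symm
    · rw [if_neg (fin_two_ne_zero n), if_neg (fin_two_ne_one n), if_pos rfl, hX2, hX2, hb.2]
      exact (tripleFamily_two _ _ _ _ _).symm
    · rw [if_neg h0, if_neg h1, if_neg h2]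
      exact (tripleFamily_of_ne _ _ _ _ h0 h1 h2).symm
  have := tripleFamily_inj.1 (uniq (fun k i =>
    if k = 0 then bitFunction c.1 (X k false i) (X k true i)
    else if k = 1 then bitFunction c.2.1 (X k false i) (X k true i)
    else if k = 2 then bitFunction c.2.2 (X k false i) (X k true i) else false) _ _
      (hψ b hb) (hψ b' hb'))
  exact hne (Prod.ext this.1 (Prod.ext this.2.1 this.2.2))

/-! ### The cyclic classical process -/

/-- Each of the parties `0`, `1`, `2` receives the output of its neighbour, shifted by `g`. -/
def cyclicFunction (n : ℕ) (g : Fin 2) (o : Fin (n + 3) → Fin 2) : Fin (n + 3) → Fin 2 :=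
  tripleFamily n (o 2 + g) (o 0 + g) (o 1 + g) 0

/-- The even mixture of the two deterministic loops. -/
def cyclicProcess (n : ℕ) : Environment (N := n + 3) (fun _ => 2) (fun _ => 2) :=
  fun i o => ∑ g, if i = cyclicFunction n g o then 1 / 2 else 0

/-- If some `f` is constant, each loop has one fixed point. Otherwise the composite around the loop
is the identity or the negation, and the three flips of `g = 1`, an odd number, exchange these
cases, so the counts are 2 and 0 in some order. -/
theorem cyclic_loops_count : ∀ f₀ f₁ f₂ : Fin 2 → Fin 2,
    ∑ c : Fin 2 × Fin 2 × Fin 2, ∑ g : Fin 2,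
      (if c.1 = f₂ c.2.2 + g ∧ c.2.1 = f₀ c.1 + g ∧ c.2.2 = f₁ c.2.1 + g then 1 else 0) = 2 := by
  decide +kernel

theorem isClassicalProcess_cyclicProcess (n : ℕ) : IsClassicalProcess (cyclicProcess n) := by
  rw [isClassicalProcess_iff]
  refine ⟨fun i o => Finset.sum_nonneg fun g _ => by positivity, fun f => ?_⟩
  have hcount := cyclic_loops_count (f 0) (f 1) (f 2)
  -- The process pins the bystanders' inputs to `0`, so only the three loop bits remain in the sum.
  rw [← Fintype.sum_of_injective
    (fun c : Fin 2 × Fin 2 × Fin 2 => tripleFamily n c.1 c.2.1 c.2.2 (0 : Fin 2))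
    (fun c c' h => by
      have := tripleFamily_inj.1 h
      exact Prod.ext this.1 (Prod.ext this.2.1 this.2.2))
    (fun c => ∑ g : Fin 2, if c.1 = f 2 c.2.2 + g ∧ c.2.1 = f 0 c.1 + g ∧ c.2.2 = f 1 c.2.1 + g
      then (1 / 2 : ℝ) else 0) _ (fun i hi => ?_) fun c => ?_]
  · have h2 : ∀ c : Fin 2 × Fin 2 × Fin 2, ∀ g : Fin 2,
        (if c.1 = f 2 c.2.2 + g ∧ c.2.1 = f 0 c.1 + g ∧ c.2.2 = f 1 c.2.1 + g
          then (1 / 2 : ℝ) else 0) = 1 / 2 * ((if c.1 = f 2 c.2.2 + g ∧ c.2.1 = f 0 c.1 + g ∧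
            c.2.2 = f 1 c.2.1 + g then 1 else 0 : ℕ) : ℝ) := fun c g => by
      split_ifs <;> simp
    simp_rw [h2, ← Finset.mul_sum]
    rw_mod_cast [hcount]
    norm_num
  · refine Finset.sum_eq_zero fun g _ => if_neg fun h => hi ⟨(i 0, i 1, i 2), ?_⟩
    rw [h]
    simp [cyclicFunction]
  · refine Finset.sum_congr rfl fun g _ => if_congr ?_ rfl rfl
    rw [cyclicFunction, tripleFamily_inj]
    simp

/-- The bit that tells whether a setting or outcome is nonzero. -/
def nonzeroBit {d : ℕ} (a : Fin d) : Bool := a.val != 0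

/-- A party outputs its setting, and returns its input as outcome. -/
def relayIntervention (M : ℕ) {D : ℕ} (hD : 2 ≤ D) : LocalIntervention M D 2 2 where
  prob x o a i := (if Fin.castLE hD i = x then 1 else 0) *
    (if (if nonzeroBit a then 1 else 0) = o then 1 else 0)
  nonneg x o a i := by positivity
  sum_one a i := by simp

/-- The probability that, summed over all settings, the outcomes are not the shifted settings or
their negations. -/
def failureScore {n M D : ℕ} {dI dO : Fin (n + 3) → ℕ}
    (L : (k : Fin (n + 3)) → LocalIntervention M D (dI k) (dO k)) (P : Environment dI dO) : ℝ :=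
  open Classical in
  ∑ a, ∑ x, if IsShiftOrNot (nonzeroBit (x 0)) (nonzeroBit (x 1)) (nonzeroBit (x 2))
    (nonzeroBit (a 0)) (nonzeroBit (a 1)) (nonzeroBit (a 2)) then 0 else classicalProb P L x a

theorem failureScore_cyclicProcess (n M : ℕ) {D : ℕ} (hD : 2 ≤ D) :
    failureScore (fun _ => relayIntervention M hD) (cyclicProcess n) = 0 := by
  classical
  refine Finset.sum_eq_zero fun a _ => Finset.sum_eq_zero fun x _ => ?_
  split_ifs with h
  · rfl
  rw [classicalProb_eq_processForm, processForm_apply]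
  refine Finset.sum_eq_zero fun i _ => Finset.sum_eq_zero fun o _ => ?_
  by_contra hne
  obtain ⟨h1, h2⟩ := mul_ne_zero_iff.1 hne
  rw [Finset.prod_ne_zero_iff] at h1
  obtain ⟨g, -, hg⟩ := Finset.exists_ne_zero_of_sum_ne_zero h2
  have hi : i = cyclicFunction n g o := by
    by_contra hi
    exact hg (if_neg hi)
  have hx : ∀ k, x k = Fin.castLE hD (i k) := fun k => by
    by_contra hk
    exact left_ne_zero_of_mul (h1 k (Finset.mem_univ k)) (if_neg (Ne.symm hk))
  have ho : ∀ k, o k = if nonzeroBit (a k) then 1 else 0 := fun k => by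
    by_contra hk
    exact right_ne_zero_of_mul (h1 k (Finset.mem_univ k)) (if_neg (Ne.symm hk))
  have hbit : ∀ (b : Bool) (g : Fin 2), nonzeroBit (Fin.castLE hD ((if b then 1 else 0) + g)) =
      xor b (nonzeroBit g) := by
    intro b g
    cases b <;> fin_cases g <;> rfl
  refine h ⟨nonzeroBit g, ?_, ?_, ?_⟩
  · rw [hx, hi, cyclicFunction, tripleFamily_zero, ho, hbit]
  · rw [hx, hi, cyclicFunction, tripleFamily_one, ho, hbit]
  · rw [hx, hi, cyclicFunction, tripleFamily_two, ho, hbit]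

/-- For each party, setting and input some outcome-output pair has positive probability. These pairs
form a deterministic strategy, which fails at some fixed point, and that event has positive
probability under `L`. -/
theorem failureScore_deltaProcess_pos {n M D : ℕ} (hM : 2 ≤ M) {dI dO : Fin (n + 3) → ℕ}
    (L : (k : Fin (n + 3)) → LocalIntervention M D (dI k) (dO k))
    {ω : ((k : Fin (n + 3)) → Fin (dO k)) → ((k : Fin (n + 3)) → Fin (dI k))}
    (hω : IsProcessFunction ω) : 0 < failureScore L (deltaProcess ω) := by
  classical
  have hex : ∀ k a i, ∃ x o, 0 < (L k).prob x o a i := by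
    intro k a i
    by_contra! hcon
    have := (L k).sum_one a i
    have h2 : ∑ x, ∑ o, (L k).prob x o a i ≤ 0 :=
      Finset.sum_nonpos fun x _ => Finset.sum_nonpos fun o _ => hcon x o
    linarith
  choose X O hXO using hex
  let m : Bool → Fin M := fun b => Fin.castLE hM (if b then 1 else 0)
  have hm : ∀ b, nonzeroBit (m b) = b := by
    intro b
    cases b <;> rfl
  obtain ⟨b, i, hi, hbad⟩ := hω.exists_not_isShiftOrNot
    (fun k b i => nonzeroBit (X k (m b) i)) fun k b i => O k (m b) i
  have hnn : ∀ a x, 0 ≤ classicalProb (deltaProcess ω) L x a := fun a x =>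
    (classicalCorrelation hω L).nonneg x a
  refine Finset.sum_pos' (fun a _ => Finset.sum_nonneg fun x _ => ?_)
    ⟨fun k => m (b k), Finset.mem_univ _, Finset.sum_pos' (fun x _ => ?_)
      ⟨fun k => X k (m (b k)) (i k), Finset.mem_univ _, ?_⟩⟩
  · split_ifs
    exacts [le_rfl, hnn _ _]
  · split_ifs
    exacts [le_rfl, hnn _ _]
  · simp only [hm]
    rw [if_neg hbad, classicalProb_eq_processForm, processForm_apply]
    have hterm : ∀ i' o', 0 ≤ (∏ k, (L k).prob (X k (m (b k)) (i k)) (o' k) (m (b k)) (i' k)) *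
        deltaProcess ω i' o' := fun i' o' =>
      mul_nonneg (Finset.prod_nonneg fun k _ => (L k).nonneg _ _ _ _) (hω.1.1 _ _)
    refine Finset.sum_pos' (fun i' _ => Finset.sum_nonneg fun o' _ => hterm i' o')
      ⟨i, Finset.mem_univ _, Finset.sum_pos' (fun o' _ => hterm i o')
        ⟨fun k => O k (m (b k)) (i k), Finset.mem_univ _, ?_⟩⟩
    rw [deltaProcess, if_pos hi, mul_one]
    exact Finset.prod_pos fun k _ => hXO _ _ _

theorem failureScore_convex {n M D : ℕ} {dI dO : Fin (n + 3) → ℕ}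
    (L : (k : Fin (n + 3)) → LocalIntervention M D (dI k) (dO k)) :
    Convex ℝ {P : Environment dI dO | 0 < failureScore L P} := by
  refine convex_halfSpace_gt ⟨fun P Q => ?_, fun c P => ?_⟩ 0
  · simp only [failureScore, ← Finset.sum_add_distrib]
    refine Finset.sum_congr rfl fun a _ => Finset.sum_congr rfl fun x _ => ?_
    split_ifs
    · simp
    · simp [classicalProb, jointProb, mul_add, Finset.sum_add_distrib]
  · simp only [failureScore, smul_eq_mul, Finset.mul_sum]
    refine Finset.sum_congr rfl fun a _ => Finset.sum_congr rfl fun x _ => ?_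
    split_ifs
    · simp
    · simp [classicalProb, jointProb, Finset.mul_sum, mul_left_comm]

theorem DC_ssubset_PC {n M D : ℕ} (hM : 2 ≤ M) (hD : 2 ≤ D) : DC (n + 3) M D ⊂ PC (n + 3) M D := by
  refine (Set.ssubset_iff_of_subset (DC_subset_PC _ _ _)).2
    ⟨classicalCorrelation (isClassicalProcess_cyclicProcess n) fun _ => relayIntervention M hD,
      classicalCorrelation_mem_PC (fun _ => two_pos) (fun _ => two_pos) _ _, ?_⟩
  rintro ⟨dI, dO, hI, hO, P, hP, L, hL⟩
  have h1 : 0 < failureScore L P := by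
    refine convexHull_min ?_ (failureScore_convex L) hP
    rintro _ ⟨ω, hω, rfl⟩
    exact failureScore_deltaProcess_pos hM L hω
  -- The score depends only on the realized correlation, so it may be computed from either
  -- realization.
  have h2 : failureScore L P = failureScore (fun _ => relayIntervention M hD) (cyclicProcess n) := by
    unfold failureScore
    simp_rw [← hL]
    rfl
  rw [h2, failureScore_cyclicProcess] at h1
  exact lt_irrefl _ h1

end

/-! ### Assembly of the statements. -/

theorem mainTheorem8 :
    -- the chain of inclusions in every correlational scenario
    (∀ N M D : ℕ, DC N M D ⊆ PC N M D ∧ PC N M D ⊆ QP N M D ∧ QP N M D ⊆ qC N M D) ∧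
    -- all three inclusions are strict for at least three parties
    (∀ N M D : ℕ, 3 ≤ N → 2 ≤ M → 2 ≤ D →
      DC N M D ⊂ PC N M D ∧ PC N M D ⊂ QP N M D ∧ QP N M D ⊂ qC N M D) ∧
    -- the bipartite case
    (∀ M D : ℕ, DC 2 M D = PC 2 M D ∧ ∀ p ∈ PC 2 M D, IsCausal p) ∧
    (∀ M D : ℕ, 2 ≤ M → 2 ≤ D → PC 2 M D ⊂ QP 2 M D ∧ QP 2 M D ⊂ qC 2 M D) ∧
    -- the two causal inequalities
    (∀ p : Correlation 2 2 2, IsCausal p → gyni p ≤ 1 / 2 ∧ lgyni p ≤ 3 / 4) ∧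
    -- their violation by the explicit qubit process matrix
    IsProcessMatrix qubitW ∧ (∀ a, IsInstrument (qubitMap a)) ∧
    (∃ p ∈ QP 2 2 2,
      (∀ x a, (p.prob x a : ℂ) = quantumProb qubitW (fun _ => qubitMap) x a) ∧
      gyni p = 5 / 16 * (1 + 1 / Real.sqrt 2) ∧ 1 / 2 < gyni p ∧
      lgyni p = 1 / 4 + 5 / 16 * (1 + 1 / Real.sqrt 2) ∧ 3 / 4 < lgyni p) := by
  refine ⟨fun N M D => ⟨DC_subset_PC N M D, PC_subset_QP N M D, QP_subset_qC N M D⟩,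
    fun N M D hN hM hD => ?_, fun M D => ⟨DC_two_eq_PC_two M D, fun p => isCausal_of_mem_PC_two⟩,
    fun M D hM hD => ⟨PC_ssubset_QP (n := 0) hM hD, QP_ssubset_qC (n := 0) hM hD⟩,
    fun p => causal_inequalities, isProcessMatrix_qubitW, isInstrument_qubitMap, qubit_violation⟩
  obtain ⟨n, rfl⟩ := Nat.exists_eq_add_of_le' hN
  exact ⟨DC_ssubset_PC hM hD, PC_ssubset_QP (n := n + 1) hM hD, QP_ssubset_qC (n := n + 1) hM hD⟩
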